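/- Let $A=\{a,b\}$, let $A^+$ be the free semigroup on $A$, and let $\tau$ be the Prouhet–Thue–Morse substitution, the endomorphism of $A^+$ with $\tau(a)=ab$ and $\tau(b)=ba$. Let $\mathcal X_\tau\subseteq A^{\mathbb Z}$ be its subshift (the biinfinite sequences all of whose finite blocks are factors of words $\tau^k(c)$ with $c\in A$ and $k$ arbitrarily large), and let $L(\mathcal X_\tau)\subseteq A^+$ be the set of finite blocks of elements of $\mathcal X_\tau$. Let $\overline{\Omega}_A\mathsf S$ be the free profinite semigroup on $A$, extend $\tau$ to a continuous endomorphism of it, let $\tau^\omega=\lim_n\tau^{n!}$ (pointwise limit), and let $J(\tau)=\overline{L(\mathcal X_\tau)}\setminus L(\mathcal X_\tau)$, the closure being taken in $\overline{\Omega}_A\mathsf S$. Let $G(\tau)$ be the intersection of the $\mathcal R$-class and the $\mathcal L$-class of $\tau^\omega(a)$ in $\overline{\Omega}_A\mathsf S$. Let $R(aa)$ be the set of return words of $aa$ in $\mathcal X_\tau$, that is, of the nonempty words $v$ such that $vaa\in L(\mathcal X_\tau)$, $aa$ is a prefix of $vaa$, and $aa$ occurs in $vaa$ only as a prefix and as a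 suffix; and let $X=X_\tau(a,a)=a^{-1}R(aa)a$. Then: 1. $aa$ is a connection for $\tau$: $aa\in L(\mathcal X_\tau)$, and $\tau^\omega(a)$ has first letter $a$ and last letter $a$; 2. $X=\{abba,\ ababba,\ abbaba,\ ababbaba\}$; 3. $G(\tau)$ is a maximal subgroup of $\overline{\Omega}_A\mathsf S$ and is contained in $J(\tau)$; 4. for each $x\in X$ the word $\tau^2(x)$ has a unique decomposition $w_x$ as a product of elements of $X$; and, if $\overline{\Omega}_X\mathsf G$ is the free profinite group on $X$, $\bar\psi$ its continuous endomorphism with $\bar\psi(x)=w_x$ for $x\in X$ (with $w_x$ regarded as a group word), and $\bar\psi^\omega=\lim_n\bar\psi^{n!}$, then the profinite group $G(\tau)$ has the presentation $$\langle X\mid \bar\psi^\omega(x)=x\ (x\in X)\rangle .$$ That is, if $N$ is the topological closure of the normal closure of $\{\bar\psi^\omega(x)x^{-1}: x\in X\}$ in $\overline{\Omega}_X\mathsf G$, there is an isomorphism of topological groups $\overline{\Omega}_X\mathsf G/N\to G(\tau)$ that sends the class of each $x\in X$ to $\tau^\omega(x)$. -/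

import Mathlib

open Filter Topology CategoryTheory

universe u v

/-! ### Powers `f ^ ω` -/

/-- The `ω`-power of a self-map in the pointwise topology: `f ^ ω (x) = lim f ^ (n!) (x)`.
For the maps used below the limit exists (`FreeProfiniteSemigroup.tendsto_omegaPower`,
`FreeProfiniteGroup.tendsto_omegaPower`), and `f ^ ω` is then the idempotent in the closure of
the positive powers of `f`. -/
noncomputable def omegaPower {S : Type u} [TopologicalSpace S] (f : S → S) (x : S) : S :=
  haveI : Nonempty S := ⟨x⟩
  limUnder atTop fun n : ℕ => f^[n.factorial] x

theorem iterate_factorial_eventually_const {Q : Type u} [Finite Q] (T : Q → Q) (q : Q) :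
    ∃ r, ∀ᶠ n : ℕ in atTop, T^[n.factorial] q = r := by
  obtain ⟨i, j, hij, h⟩ := Finite.exists_ne_map_eq_of_infinite fun n : ℕ => T^[n] q
  wlog hlt : i < j generalizing i j
  · exact this j i hij.symm h.symm (by omega)
  obtain ⟨p, rfl⟩ := Nat.exists_eq_add_of_lt hlt
  have hstep : ∀ k, T^[i + k * (p + 1)] q = T^[i] q := by
    intro k
    induction k with
    | zero => simp
    | succ k ih =>
      have : i + (k + 1) * (p + 1) = k * (p + 1) + (i + p + 1) := by ring
      rw [this, Function.iterate_add_apply, ← show T^[i] q = T^[i + p + 1] q from h,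
        ← Function.iterate_add_apply, add_comm, ih]
  have hper : ∀ m k, i ≤ m → T^[m + k * (p + 1)] q = T^[m] q := by
    intro m k hm
    obtain ⟨l, rfl⟩ := Nat.exists_eq_add_of_le hm
    have : i + l + k * (p + 1) = l + (i + k * (p + 1)) := by ring
    rw [this, Function.iterate_add_apply, hstep, ← Function.iterate_add_apply, add_comm]
  refine ⟨T^[(i + p + 1).factorial] q, ?_⟩
  filter_upwards [eventually_ge_atTop (i + p + 1)] with n hn
  have hle : (i + p + 1).factorial ≤ n.factorial := Nat.factorial_le hn
  have hd : p + 1 ∣ n.factorial - (i + p + 1).factorial :=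
    Nat.dvd_sub (Nat.dvd_factorial (by omega) (by omega))
      (Nat.dvd_factorial (by omega) (by omega))
  obtain ⟨k, hk⟩ := hd
  have : n.factorial = (i + p + 1).factorial + k * (p + 1) := by
    rw [mul_comm k, ← hk]; omega
  rw [this, hper _ _ (le_trans (by omega) (Nat.self_le_factorial _))]

theorem comp_iterate_factorial_eventually_const {S : Type u} {Q : Type v} (f : S → S)
    (F : Set (S → Q)) (hF : F.Finite) (hf : ∀ θ ∈ F, θ ∘ f ∈ F) (θ : S → Q) (hθ : θ ∈ F) (x : S) :
    ∃ r, ∀ᶠ n : ℕ in atTop, θ (f^[n.factorial] x) = r := by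
  have : Finite F := hF
  let T : F → F := fun θ => ⟨θ.1 ∘ f, hf _ θ.2⟩
  have hT : ∀ n (η : F), (T^[n] η).1 = η.1 ∘ f^[n] := by
    intro n
    induction n with
    | zero => intro η; rfl
    | succ n ih =>
      intro η
      rw [Function.iterate_succ_apply, ih, Function.iterate_succ']
      rfl
  obtain ⟨r, hr⟩ := iterate_factorial_eventually_const T ⟨θ, hθ⟩
  refine ⟨r.1 x, ?_⟩
  filter_upwards [hr] with n hn
  rw [← hn, hT]
  rfl

/-! ### The free profinite semigroup -/

/-- Congruences of finite index on the free semigroup `A⁺`. -/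
abbrev FiniteCon (A : Type u) : Type u := {c : Con (FreeSemigroup A) // Finite c.Quotient}

/-- The projective limit of all finite quotients of `A⁺`: the compatible families in the product
of these quotients. -/
def freeProfiniteSubsemigroup (A : Type u) : Subsemigroup (∀ c : FiniteCon A, c.1.Quotient) where
  carrier := {f | ∀ c d : FiniteCon A, c.1 ≤ d.1 → ∀ w : FreeSemigroup A,
    f c = (w : c.1.Quotient) → f d = (w : d.1.Quotient)}
  mul_mem' := by
    intro f g hf hg c d hcd w hw
    obtain ⟨x, hx⟩ := Quotient.exists_rep (f c)
    obtain ⟨y, hy⟩ := Quotient.exists_rep (g c)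
    have hx' : f c = (x : c.1.Quotient) := hx.symm
    have hy' : g c = (y : c.1.Quotient) := hy.symm
    have hxy : ((x * y : FreeSemigroup A) : c.1.Quotient) = w := by
      rw [← hw, Pi.mul_apply, hx', hy', Con.coe_mul]
    rw [Pi.mul_apply, hf c d hcd x hx', hg c d hcd y hy', ← Con.coe_mul]
    exact (Con.eq _).2 (hcd ((Con.eq _).1 hxy))

/-- The free profinite semigroup on the finite alphabet `A`. -/
def FreeProfiniteSemigroup (A : Type u) : Type u := freeProfiniteSubsemigroup A

namespace FreeProfiniteSemigroup

variable {A : Type u}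

instance : Semigroup (FreeProfiniteSemigroup A) :=
  inferInstanceAs (Semigroup (freeProfiniteSubsemigroup A))

/-- The topology of a projective limit of finite discrete spaces. -/
instance : TopologicalSpace (FreeProfiniteSemigroup A) :=
  TopologicalSpace.induced (fun x (c : FiniteCon A) => x.1 c)
    (@Pi.topologicalSpace (FiniteCon A) (fun c => c.1.Quotient) fun _ => ⊥)

/-- The canonical embedding of `A⁺`. -/
def ofWord : FreeSemigroup A →ₙ* FreeProfiniteSemigroup A where
  toFun w := ⟨fun c => (w : c.1.Quotient), fun _ _ h _ hw =>
    (Con.eq _).2 (h ((Con.eq _).1 hw))⟩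
  map_mul' _ _ := rfl

theorem finite_ker_quotient {Q : Type v} [Mul Q] [Finite Q] (θ : FreeSemigroup A →ₙ* Q) :
    Finite (Con.ker θ).Quotient :=
  Finite.of_injective (fun q : (Con.ker θ).Quotient => Con.liftOn q θ fun _ _ h => h) (by
    rintro ⟨x⟩ ⟨y⟩ h
    exact (Con.eq _).2 h)

/-- The continuous extension of a homomorphism from `A⁺` into a finite semigroup. -/
def liftFun {Q : Type v} [Mul Q] [Finite Q] (θ : FreeSemigroup A →ₙ* Q)
    (x : FreeProfiniteSemigroup A) : Q :=
  Con.liftOn (x.1 ⟨Con.ker θ, finite_ker_quotient θ⟩) θ fun _ _ h => h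

theorem liftFun_eq {Q : Type v} [Mul Q] [Finite Q] (θ : FreeSemigroup A →ₙ* Q)
    (x : FreeProfiniteSemigroup A) (c : FiniteCon A) (hc : c.1 ≤ Con.ker θ)
    (w : FreeSemigroup A) (hw : x.1 c = (w : c.1.Quotient)) : liftFun θ x = θ w := by
  unfold liftFun
  rw [x.2 c ⟨Con.ker θ, finite_ker_quotient θ⟩ hc w hw]
  rfl

theorem exists_word (x : FreeProfiniteSemigroup A) (c : FiniteCon A) :
    ∃ w : FreeSemigroup A, x.1 c = (w : c.1.Quotient) := by
  obtain ⟨w, hw⟩ := Quotient.exists_rep (x.1 c)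
  exact ⟨w, hw.symm⟩

/-- The coordinate of `x` at the kernel of a homomorphism into a finite semigroup. -/
theorem exists_word_lift {Q : Type v} [Mul Q] [Finite Q] (θ : FreeSemigroup A →ₙ* Q)
    (x : FreeProfiniteSemigroup A) : ∃ w : FreeSemigroup A,
      x.1 ⟨Con.ker θ, finite_ker_quotient θ⟩ = (w : (Con.ker θ).Quotient) ∧ liftFun θ x = θ w := by
  obtain ⟨w, hw⟩ := exists_word x ⟨Con.ker θ, finite_ker_quotient θ⟩
  exact ⟨w, hw, liftFun_eq θ x ⟨Con.ker θ, finite_ker_quotient θ⟩ le_rfl w hw⟩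

/-- The continuous homomorphism between free profinite semigroups that extends a homomorphism
`A⁺ → B⁺`. -/
def map {B : Type v} (φ : FreeSemigroup A →ₙ* FreeSemigroup B) :
    FreeProfiniteSemigroup A →ₙ* FreeProfiniteSemigroup B where
  toFun x := ⟨fun c => haveI := c.2; liftFun (c.1.mkMulHom.comp φ) x, by
    intro c d h w hw
    have := c.2
    have := d.2
    obtain ⟨y, hy, hy'⟩ := exists_word_lift (c.1.mkMulHom.comp φ) x
    have e : liftFun (d.1.mkMulHom.comp φ) x = (d.1.mkMulHom.comp φ) y := by
      refine liftFun_eq _ _ ⟨_, finite_ker_quotient (c.1.mkMulHom.comp φ)⟩ ?_ y hy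
      intro s t hst
      exact (Con.eq _).2 (h ((Con.eq _).1 hst))
    change liftFun (d.1.mkMulHom.comp φ) x = _
    rw [e]
    have e' : (c.1.mkMulHom.comp φ) y = (w : c.1.Quotient) := by rw [← hy']; exact hw
    exact (Con.eq _).2 (h ((Con.eq _).1 e'))⟩
  map_mul' x y := by
    apply Subtype.ext
    funext c
    have := c.2
    obtain ⟨s, hs, hs'⟩ := exists_word_lift (c.1.mkMulHom.comp φ) x
    obtain ⟨t, ht, ht'⟩ := exists_word_lift (c.1.mkMulHom.comp φ) y
    change liftFun (c.1.mkMulHom.comp φ) (x * y) =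
      liftFun (c.1.mkMulHom.comp φ) x * liftFun (c.1.mkMulHom.comp φ) y
    rw [hs', ht', ← map_mul]
    refine liftFun_eq _ _ ⟨_, finite_ker_quotient (c.1.mkMulHom.comp φ)⟩ le_rfl _ ?_
    change x.1 _ * y.1 _ = _
    rw [hs, ht]
    rfl

theorem liftFun_map {B : Type v} (φ : FreeSemigroup A →ₙ* FreeSemigroup B) {Q : Type v} [Mul Q]
    [Finite Q] (θ : FreeSemigroup B →ₙ* Q) (x : FreeProfiniteSemigroup A) :
    liftFun θ (map φ x) = liftFun (θ.comp φ) x := by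
  have := finite_ker_quotient θ
  obtain ⟨w, hw, hw'⟩ := exists_word_lift ((Con.ker θ).mkMulHom.comp φ) x
  have h1 : liftFun θ (map φ x) = θ (φ w) :=
    liftFun_eq θ _ ⟨_, finite_ker_quotient θ⟩ le_rfl (φ w) hw'
  have h2 : liftFun (θ.comp φ) x = (θ.comp φ) w := by
    refine liftFun_eq _ _ ⟨_, finite_ker_quotient ((Con.ker θ).mkMulHom.comp φ)⟩ ?_ w hw
    intro s t hst
    exact (Con.eq (Con.ker θ)).1 hst
  rw [h1, h2]
  rfl

/-- The limit defining `φ ^ ω` exists. -/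
theorem tendsto_omegaPower [Finite A] (φ : FreeSemigroup A →ₙ* FreeSemigroup A)
    (x : FreeProfiniteSemigroup A) :
    Tendsto (fun n : ℕ => (map φ)^[n.factorial] x) atTop (𝓝 (omegaPower (map φ) x)) := by
  have key : ∀ c : FiniteCon A, ∃ r : c.1.Quotient,
      ∀ᶠ n : ℕ in atTop, ((map φ)^[n.factorial] x).1 c = r := by
    intro c
    have := c.2
    have hfin : (Set.range fun θ : FreeSemigroup A →ₙ* c.1.Quotient => liftFun θ).Finite := by
      have : Finite (FreeSemigroup A →ₙ* c.1.Quotient) :=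
        Finite.of_equiv _ (FreeSemigroup.lift (α := A) (β := c.1.Quotient))
      exact Set.finite_range _
    obtain ⟨r, hr⟩ := comp_iterate_factorial_eventually_const (map φ) _ hfin (by
      rintro _ ⟨θ, rfl⟩
      exact ⟨θ.comp φ, funext fun y => (liftFun_map φ θ y).symm⟩)
      (liftFun c.1.mkMulHom) ⟨_, rfl⟩ x
    refine ⟨r, hr.mono fun n hn => ?_⟩
    rw [← hn]
    obtain ⟨w, hw⟩ := exists_word ((map φ)^[n.factorial] x) c
    rw [hw]
    exact (liftFun_eq c.1.mkMulHom _ c (fun {s t} h => (Con.eq _).2 h) w hw).symm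
  choose r hr using key
  have hmem : r ∈ freeProfiniteSubsemigroup A := by
    intro c d h w hw
    obtain ⟨n, hn, hn'⟩ := ((hr c).and (hr d)).exists
    rw [← hn']
    exact ((map φ)^[n.factorial] x).2 c d h w (hn.trans hw)
  let y : FreeProfiniteSemigroup A := ⟨r, hmem⟩
  refine tendsto_nhds_limUnder ⟨y, ?_⟩
  let _ : ∀ c : FiniteCon A, TopologicalSpace c.1.Quotient := fun _ => ⊥
  rw [nhds_induced, tendsto_comap_iff, tendsto_pi_nhds]
  intro c
  exact tendsto_const_nhds.congr' ((hr c).mono fun n hn => hn.symm)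

end FreeProfiniteSemigroup

/-! ### Green's relations and maximal subgroups of a semigroup -/

/-- `x 𝓡 y`: the right ideals `x S¹` and `y S¹` coincide. -/
def GreenR {S : Type u} [Semigroup S] (x y : S) : Prop :=
  (∃ s : WithOne S, (x : WithOne S) * s = y) ∧ ∃ t : WithOne S, (y : WithOne S) * t = x

/-- `x 𝓛 y`: the left ideals `S¹ x` and `S¹ y` coincide. -/
def GreenL {S : Type u} [Semigroup S] (x y : S) : Prop :=
  (∃ s : WithOne S, s * (x : WithOne S) = y) ∧ ∃ t : WithOne S, t * (y : WithOne S) = x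

/-- `H` is a subgroup of the semigroup `S`: a subsemigroup that is a group (whose neutral element
is some idempotent of `S`). -/
def IsSubgroupOfSemigroup {S : Type u} [Semigroup S] (H : Set S) : Prop :=
  (∀ x ∈ H, ∀ y ∈ H, x * y ∈ H) ∧
    ∃ e ∈ H, ∀ x ∈ H, e * x = x ∧ x * e = x ∧ ∃ y ∈ H, x * y = e ∧ y * x = e

/-! ### Substitutions, their subshifts, and return words -/

/-- The letters of a word, in order. -/
def FreeSemigroup.letters {A : Type u} (w : FreeSemigroup A) : List A := w.head :: w.tail

/-- A substitution over `A` is an endomorphism of `A⁺`. -/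
abbrev Substitution (A : Type u) : Type u := FreeSemigroup A →ₙ* FreeSemigroup A

namespace Substitution

variable {A : Type u} (φ : Substitution A)

/-- The words that are factors of `φ ^ k (a)` for some letter `a` and arbitrarily large `k`. -/
def language : Set (FreeSemigroup A) :=
  {w | ∀ N : ℕ, ∃ k ≥ N, ∃ a : A, w.letters <:+: (φ^[k] (FreeSemigroup.of a)).letters}

/-- `w` is a finite block of the biinfinite sequence `x`. -/
def IsBlock (x : ℤ → A) (w : FreeSemigroup A) : Prop :=
  ∃ n : ℤ, w.letters = (List.range w.letters.length).map fun i => x (n + i)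

/-- The subshift `X_φ ⊆ A ^ ℤ`: the sequences all of whose finite blocks are in the language of
`φ`. -/
def subshift : Set (ℤ → A) := {x | ∀ w, IsBlock x w → w ∈ φ.language}

/-- `L(X_φ)`, the set of finite blocks of elements of `X_φ`. -/
def blocks : Set (FreeSemigroup A) := {w | ∃ x ∈ φ.subshift, IsBlock x w}

/-- The continuous endomorphism of the free profinite semigroup extending `φ`. -/
abbrev hat : FreeProfiniteSemigroup A →ₙ* FreeProfiniteSemigroup A := FreeProfiniteSemigroup.map φ

/-- `φ ^ ω (w)` for a word `w`. -/
noncomputable def omega (w : FreeSemigroup A) : FreeProfiniteSemigroup A :=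
  omegaPower φ.hat (FreeProfiniteSemigroup.ofWord w)

/-- `J(φ)`: the elements of the topological closure of `L(X_φ)` in the free profinite semigroup
that are not in `L(X_φ)`. -/
def J : Set (FreeProfiniteSemigroup A) :=
  closure (FreeProfiniteSemigroup.ofWord '' φ.blocks) \ FreeProfiniteSemigroup.ofWord '' φ.blocks

/-- The two-letter word `ba` is a connection for `φ`: it is in `L(X_φ)`, the first letter of
`φ ^ ω (a)` is `a`, and the last letter of `φ ^ ω (b)` is `b`. -/
def IsConnection (b a : A) : Prop :=
  FreeSemigroup.of b * FreeSemigroup.of a ∈ φ.blocks ∧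
    (∃ s : WithOne (FreeProfiniteSemigroup A),
      (FreeProfiniteSemigroup.ofWord (FreeSemigroup.of a) : WithOne (FreeProfiniteSemigroup A)) * s
        = φ.omega (FreeSemigroup.of a)) ∧
    ∃ s : WithOne (FreeProfiniteSemigroup A),
      s * (FreeProfiniteSemigroup.ofWord (FreeSemigroup.of b) : WithOne (FreeProfiniteSemigroup A))
        = φ.omega (FreeSemigroup.of b)

/-- `G(φ)` for the connection `ba`: the intersection of the `𝓡`-class of `φ ^ ω (a)` with the
`𝓛`-class of `φ ^ ω (b)`. -/
def G (b a : A) : Set (FreeProfiniteSemigroup A) :=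
  {x | GreenR x (φ.omega (FreeSemigroup.of a)) ∧ GreenL x (φ.omega (FreeSemigroup.of b))}

/-- The return words of `w` in `X_φ`: the nonempty words `v` such that `v w` is in `L(X_φ)`,
has `w` as a prefix, and contains `w` only as a prefix and as a suffix. -/
def returnWords (w : FreeSemigroup A) : Set (FreeSemigroup A) :=
  {v | v * w ∈ φ.blocks ∧ w.letters <+: (v * w).letters ∧
    ∀ p s : List A, (v * w).letters = p ++ w.letters ++ s → p = [] ∨ s = []}

/-- `X_φ(a, b) = b⁻¹ R(ba) b`, where `R(ba)` is the set of return words of `ba`. -/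
def returnSet (a b : A) : Set (FreeSemigroup A) :=
  {x | ∃ v ∈ φ.returnWords (FreeSemigroup.of b * FreeSemigroup.of a),
    FreeSemigroup.of b * x = v * FreeSemigroup.of b}

end Substitution

/-- The homomorphism `i : X⁺ → A⁺` that is the identity on `X`, for a set `X` of words over `A`. -/
def wordInclusion {A : Type u} (X : Set (FreeSemigroup A)) : FreeSemigroup X →ₙ* FreeSemigroup A :=
  FreeSemigroup.lift Subtype.val

/-! ### The free profinite group and profinite presentations -/

/-- The free profinite group on the finite set `X`. -/
abbrev FreeProfiniteGroup (X : Type u) : ProfiniteGrp.{u} :=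
  ProfiniteGrp.ProfiniteCompletion.completion (GrpCat.of (FreeGroup X))

namespace FreeProfiniteGroup

variable {X : Type u}

/-- The canonical map from the (discrete) free group. -/
def ofFree (w : FreeGroup X) : FreeProfiniteGroup X :=
  ProfiniteGrp.ProfiniteCompletion.eta (GrpCat.of (FreeGroup X)) w

/-- The free generators. -/
def of (x : X) : FreeProfiniteGroup X := ofFree (FreeGroup.of x)

/-- A semigroup word over `X`, regarded as a group word. -/
def groupWord : FreeSemigroup X →ₙ* FreeGroup X := FreeSemigroup.lift FreeGroup.of

/-- The continuous endomorphism that sends each generator `x` to the word `w x`, regarded as a group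
word. -/
noncomputable def endOfWords (w : X → FreeSemigroup X) :
    FreeProfiniteGroup X →ₜ* FreeProfiniteGroup X :=
  (ProfiniteGrp.profiniteCompletion.map
    (GrpCat.ofHom (FreeGroup.lift fun x => groupWord (w x)))).hom

theorem endOfWords_of (w : X → FreeSemigroup X) (x : X) :
    endOfWords w (of x) = ofFree (groupWord (w x)) := by
  have h := ConcreteCategory.congr_hom (ProfiniteGrp.ProfiniteCompletion.lift_eta
    (GrpCat.ofHom (FreeGroup.lift fun x => groupWord (w x)) ≫
      ProfiniteGrp.ProfiniteCompletion.eta (GrpCat.of (FreeGroup X)))) (FreeGroup.of x)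
  refine Eq.trans h ?_
  change ofFree (FreeGroup.lift (fun x => groupWord (w x)) (FreeGroup.of x)) = _
  rw [FreeGroup.lift_apply_of]

/-- The limit defining `f ^ ω` exists for every continuous endomorphism `f`. -/
theorem tendsto_omegaPower [Finite X] (f : FreeProfiniteGroup X →ₜ* FreeProfiniteGroup X)
    (x : FreeProfiniteGroup X) :
    Tendsto (fun n : ℕ => f^[n.factorial] x) atTop (𝓝 (omegaPower f x)) := by
  have key : ∀ H : FiniteIndexNormalSubgroup (FreeGroup X), ∃ r : FreeGroup X ⧸ H.toSubgroup,
      ∀ᶠ n : ℕ in atTop, (f^[n.factorial] x).1 H = r := by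
    intro H
    let _ : TopologicalSpace (FreeGroup X ⧸ H.toSubgroup) := ⊥
    have : DiscreteTopology (FreeGroup X ⧸ H.toSubgroup) := ⟨rfl⟩
    have hinj : Function.Injective
        fun (θ : FreeProfiniteGroup X →ₜ* (FreeGroup X ⧸ H.toSubgroup)) (y : X) => θ (of y) := by
      intro θ η h
      have h1 : θ.toMonoidHom.comp
            (ProfiniteGrp.ProfiniteCompletion.eta (GrpCat.of (FreeGroup X))).hom =
          η.toMonoidHom.comp
            (ProfiniteGrp.ProfiniteCompletion.eta (GrpCat.of (FreeGroup X))).hom :=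
        FreeGroup.ext_hom _ _ fun y => congrFun h y
      have h2 : (θ : FreeProfiniteGroup X → FreeGroup X ⧸ H.toSubgroup) = η :=
        (ProfiniteGrp.ProfiniteCompletion.denseRange (GrpCat.of (FreeGroup X))).equalizer
          θ.continuous_toFun η.continuous_toFun (funext fun w => DFunLike.congr_fun h1 w)
      exact DFunLike.coe_injective h2
    have hfin : (Set.range fun (θ : FreeProfiniteGroup X →ₜ* (FreeGroup X ⧸ H.toSubgroup))
        (y : FreeProfiniteGroup X) => θ y).Finite := by
      have : Finite (FreeProfiniteGroup X →ₜ* (FreeGroup X ⧸ H.toSubgroup)) :=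
        Finite.of_injective _ hinj
      exact Set.finite_range _
    let p : FreeProfiniteGroup X →ₜ* (FreeGroup X ⧸ H.toSubgroup) :=
      { toFun := fun y => y.1 H
        map_one' := rfl
        map_mul' := fun _ _ => rfl
        continuous_toFun := (continuous_apply H).comp continuous_subtype_val }
    exact comp_iterate_factorial_eventually_const f _ hfin (by
      rintro _ ⟨θ, rfl⟩
      exact ⟨θ.comp f, rfl⟩) (fun y => y.1 H) ⟨p, rfl⟩ x
  choose r hr using key
  have hmem : r ∈ ProfiniteGrp.limitConePtAux
      (ProfiniteGrp.ProfiniteCompletion.diagram (GrpCat.of (FreeGroup X))) := by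
    intro H K π
    obtain ⟨n, hn, hn'⟩ := ((hr H).and (hr K)).exists
    rw [← hn, ← hn']
    exact (f^[n.factorial] x).2 π
  refine tendsto_nhds_limUnder ⟨⟨r, hmem⟩, ?_⟩
  refine tendsto_subtype_rng.2 (tendsto_pi_nhds.2 fun H => ?_)
  exact tendsto_const_nhds.congr' ((hr H).mono fun n hn => hn.symm)

end FreeProfiniteGroup

/-- The profinite group presented by generators `X` and relators `R` in the free profinite group:
the quotient by the topological closure of the normal closure of `R`. -/
abbrev PresentedProfiniteGroup {X : Type u} (R : Set (FreeProfiniteGroup X)) : Type u :=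
  FreeProfiniteGroup X ⧸ (Subgroup.normalClosure R).topologicalClosure

instance {X : Type u} (R : Set (FreeProfiniteGroup X)) :
    (Subgroup.normalClosure R).topologicalClosure.Normal :=
  Subgroup.is_normal_topologicalClosure _

/-- The relators `f ^ ω (x) x⁻¹`, for `x` in `X`, that express the relations `f ^ ω (x) = x`. -/
def omegaRelators {X : Type u} (f : FreeProfiniteGroup X →ₜ* FreeProfiniteGroup X) :
    Set (FreeProfiniteGroup X) :=
  {r | ∃ x : X, r = omegaPower f (FreeProfiniteGroup.of x) * (FreeProfiniteGroup.of x)⁻¹}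

/-! ### The Prouhet–Thue–Morse substitution -/

/-- The two-letter alphabet `{a, b}`. -/
inductive AB : Type
  | a
  | b
  deriving DecidableEq

instance : Fintype AB := ⟨{.a, .b}, fun x => by cases x <;> decide⟩

/-- The word with the given first letter and remaining letters. -/
def AB.word (x : AB) (l : List AB) : FreeSemigroup AB := ⟨x, l⟩

/-- The Prouhet–Thue–Morse substitution `τ`, with `τ(a) = ab` and `τ(b) = ba`. -/
def thueMorse : Substitution AB :=
  FreeSemigroup.lift fun
    | .a => FreeSemigroup.of .a * FreeSemigroup.of .b
    | .b => FreeSemigroup.of .b * FreeSemigroup.of .a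

/-! ### Combinatorics of the Thue–Morse language -/

namespace FreeSemigroup

variable {A : Type u}

/-! Write S for the free profinite semigroup, α = τ^ω(a), X = a⁻¹R(aa)a, i : X⁺ → A⁺ for the
inclusion, and ψ for the endomorphism of X⁺ with i∘ψ = τ²∘i.

Two combinatorial facts carry the proof. The occurrences of aa cut a word that starts and ends with
a, and is flanked by a's in a block, into elements of X, in only one way; so X is a code
(`exists_decomposition`, `eq_of_flatten_eq`). And τ is synchronizing: a word between two copies of
τ^m(aa) in a block is itself an image under τ^m (`IsFactor.desubstitute`). That X has exactly four
elements is a finite check on the words τ⁴(xy) (`mem_pieces`).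

Since aa is a block, α² is a factor of α. Stability of compact semigroups then puts α² in the
𝓗-class of α, which is therefore the group of units of eSe for an idempotent e. The same argument
puts τ^ω(x) in G(τ) for x in X, and the universal property gives a continuous homomorphism Θ from
the free profinite group on X to G(τ) with Θ(x) = τ^ω(x).

Θ is onto by compactness and density (`G_subset_closure_range`): elements of G(τ) are approximated
by words τ^m(a) t τ^m(a) with τ^m(aa) t τ^m(aa) a block, and synchronization turns these into τ^m of
products over X.

The relations hold because Θ(ψ^n(v)) = τ^ω(τ^{2n}(i(v))). Conversely, let η be a finite quotient of
the free profinite group in which they hold. As X is a code, some finite semigroup image of i(v)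
determines η(v) (`TrackValues.trackHom`). In it τ^ω(i(v)) takes the value of i(ψ^{n!}(v)) for
suitable n, while η(ψ^{n!}(v)) = η(v) by the relations; so Θ(v) determines η(v). Positive words are
dense, hence the kernel of Θ lies in every open normal subgroup that contains the relators, and so
in N. -/

theorem letters_mul (u v : FreeSemigroup A) : (u * v).letters = u.letters ++ v.letters := rfl

theorem letters_of (x : A) : (of x).letters = [x] := rfl

theorem letters_ne_nil (w : FreeSemigroup A) : w.letters ≠ [] := List.cons_ne_nil _ _

theorem letters_injective : Function.Injective (letters : FreeSemigroup A → List A) := by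
  rintro ⟨x, l⟩ ⟨y, m⟩ h
  simpa [letters] using h

theorem exists_letters_eq {l : List A} (h : l ≠ []) : ∃ w : FreeSemigroup A, w.letters = l := by
  cases l with
  | nil => exact absurd rfl h
  | cons x l => exact ⟨⟨x, l⟩, rfl⟩

end FreeSemigroup

namespace ThueMorse

/-- The exchange of the two letters. -/
def flip : AB → AB
  | .a => .b
  | .b => .a

theorem flip_ne (x : AB) : flip x ≠ x := by cases x <;> decide

theorem flip_flip (x : AB) : flip (flip x) = x := by cases x <;> rfl

/-- The Thue–Morse substitution on lists of letters. -/
def sub : List AB → List AB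
  | [] => []
  | x :: l => x :: flip x :: sub l

@[simp] theorem sub_nil : sub [] = [] := rfl

@[simp] theorem sub_cons (x : AB) (l : List AB) : sub (x :: l) = x :: flip x :: sub l := rfl

@[simp] theorem sub_append (l m : List AB) : sub (l ++ m) = sub l ++ sub m := by
  induction l with
  | nil => rfl
  | cons x l ih => simp [ih]

theorem length_sub (l : List AB) : (sub l).length = 2 * l.length := by
  induction l with
  | nil => rfl
  | cons x l ih => simp [ih]; ring

theorem iterate_sub_append (k : ℕ) (l m : List AB) :
    sub^[k] (l ++ m) = sub^[k] l ++ sub^[k] m := by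
  induction k generalizing l m with
  | zero => rfl
  | succ k ih => simp [Function.iterate_succ_apply, ih]

theorem iterate_sub_nil (k : ℕ) : sub^[k] [] = [] :=
  Function.iterate_fixed sub_nil k

theorem length_iterate_sub (k : ℕ) (l : List AB) : (sub^[k] l).length = 2 ^ k * l.length := by
  induction k generalizing l with
  | zero => simp
  | succ k ih => rw [Function.iterate_succ_apply, ih, length_sub]; ring

theorem letters_thueMorse (w : FreeSemigroup AB) : (thueMorse w).letters = sub w.letters := by
  induction w using FreeSemigroup.recOnMul with
  | ih1 x => cases x <;> rfl
  | ih2 x w h1 h2 => rw [map_mul, FreeSemigroup.letters_mul, FreeSemigroup.letters_mul, sub_append,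
      h1, h2]

theorem letters_iterate_thueMorse (k : ℕ) (w : FreeSemigroup AB) :
    (thueMorse^[k] w).letters = sub^[k] w.letters := by
  induction k generalizing w with
  | zero => rfl
  | succ k ih => rw [Function.iterate_succ_apply, Function.iterate_succ_apply, ih,
      letters_thueMorse]

theorem iterate_sub_infix {l m : List AB} (k : ℕ) (h : l <:+: m) : sub^[k] l <:+: sub^[k] m := by
  obtain ⟨p, q, rfl⟩ := h
  exact ⟨sub^[k] p, sub^[k] q, by simp [iterate_sub_append]⟩

theorem iterate_sub_prefix {j k : ℕ} (h : j ≤ k) : sub^[j] [.a] <+: sub^[k] [.a] := by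
  induction k, h using Nat.le_induction with
  | base => exact List.prefix_rfl
  | succ k _ ih =>
    refine ih.trans ⟨sub^[k] [.b], ?_⟩
    rw [← iterate_sub_append]
    rfl

/-- Only even exponents work: τ(a) = ab ends with b, while τ²(a) = abba ends with a. -/
theorem iterate_sub_suffix {j k : ℕ} (h : j ≤ k) : sub^[2 * j] [.a] <:+ sub^[2 * k] [.a] := by
  induction k, h using Nat.le_induction with
  | base => exact List.suffix_rfl
  | succ k _ ih =>
    refine ih.trans ⟨sub^[2 * k] [.a, .b, .b], ?_⟩
    rw [← iterate_sub_append, show 2 * (k + 1) = 2 * k + 2 by ring, Function.iterate_add_apply]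
    rfl

/-- The factors of the words `τ ^ k (a)`. -/
def IsFactor (l : List AB) : Prop := ∃ k, l <:+: sub^[k] [.a]

theorem IsFactor.mono {l m : List AB} (hm : IsFactor m) (h : l <:+: m) : IsFactor l :=
  let ⟨k, hk⟩ := hm
  ⟨k, h.trans hk⟩

theorem IsFactor.eventually {l : List AB} (h : IsFactor l) :
    ∃ K, ∀ k ≥ K, l <:+: sub^[k] [.a] :=
  let ⟨K, hK⟩ := h
  ⟨K, fun _ hk => hK.trans (iterate_sub_prefix hk).isInfix⟩

theorem IsFactor.iterate_sub {l : List AB} (h : IsFactor l) (k : ℕ) : IsFactor (sub^[k] l) := by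
  obtain ⟨j, hj⟩ := h
  refine ⟨k + j, ?_⟩
  rw [Function.iterate_add_apply]
  exact iterate_sub_infix k hj

theorem isFactor_singleton (x : AB) : IsFactor [x] := by
  cases x
  · exact ⟨0, [], [], rfl⟩
  · exact ⟨1, [.a], [], rfl⟩

theorem isFactor_aa : IsFactor [.a, .a] := ⟨3, [.a, .b, .b, .a, .b], [.b], rfl⟩

/-! #### Desubstitution -/

/-- Three consecutive letters of an image contain a complete block `x :: flip x`, whose two letters
differ. -/
theorem append_cube_ne_sub (m p q : List AB) (x : AB) : p ++ x :: x :: x :: q ≠ sub m := by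
  induction m generalizing p with
  | nil => simp
  | cons y m ih =>
    rcases p with - | ⟨z, - | ⟨z', p⟩⟩
    · simp only [List.nil_append, sub_cons, ne_eq, List.cons.injEq, not_and]
      rintro rfl h
      exact absurd h.symm (flip_ne x)
    · simp only [List.singleton_append, sub_cons, ne_eq, List.cons.injEq, not_and]
      rintro - rfl h
      cases m with
      | nil => simp at h
      | cons t m =>
        simp only [sub_cons, List.cons.injEq] at h
        obtain ⟨h1, h2, -⟩ := h
        exact flip_ne t (h2.symm.trans h1)
    · simp only [List.cons_append, sub_cons, ne_eq, List.cons.injEq, not_and]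
      exact fun _ _ => ih p

/-- No letter occurs three times in a row. -/
def CubeFree (l : List AB) : Prop := ∀ x, ¬ [x, x, x] <:+: l

theorem CubeFree.mono {l m : List AB} (hm : CubeFree m) (h : l <:+: m) : CubeFree l :=
  fun x hx => hm x (hx.trans h)

theorem cubeFree_sub (l : List AB) : CubeFree (sub l) := by
  rintro x ⟨p, q, h⟩
  exact append_cube_ne_sub l p q x (by simpa using h)

theorem cubeFree_iterate_sub {l : List AB} (h : CubeFree l) (k : ℕ) : CubeFree (sub^[k] l) := by
  cases k with
  | zero => exact h
  | succ k => rw [Function.iterate_succ_apply']; exact cubeFree_sub _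

theorem cubeFree_singleton (x : AB) : CubeFree [x] := fun _ h => by
  have := h.length_le
  simp at this

theorem sub_eq_sub_append {y v q : List AB} (h : sub y = sub v ++ q) :
    ∃ q', q = sub q' ∧ y = v ++ q' := by
  induction v generalizing y with
  | nil => exact ⟨y, h.symm, rfl⟩
  | cons x v ih =>
    cases y with
    | nil => simp at h
    | cons z y =>
      simp only [sub_cons, List.cons_append, List.cons.injEq] at h
      obtain ⟨rfl, -, h⟩ := h
      obtain ⟨q', hq, rfl⟩ := ih h
      exact ⟨q', hq, rfl⟩

/-- Synchronization: in a word `τ(y)` without cubes of letters in `y`, a word `τ(v)` with `|v| ≥ 2`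
occurs only at the expected places. -/
theorem desubstitute {y p v q : List AB} (hy : CubeFree y) (hv : 2 ≤ v.length)
    (h : sub y = p ++ sub v ++ q) :
    ∃ p' q', p = sub p' ∧ q = sub q' ∧ y = p' ++ v ++ q' := by
  induction y generalizing p with
  | nil =>
    have := congrArg List.length h
    simp [length_sub] at this
    omega
  | cons x y ih =>
    rcases p with - | ⟨z, - | ⟨z', p⟩⟩
    · obtain ⟨q', hq, hy'⟩ := sub_eq_sub_append (y := x :: y) (by simpa using h)
      exact ⟨[], q', rfl, hq, hy'⟩
    -- At offset one the blocks straddle each other; comparing letters gives x = y₀ = y₁ = `flip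
    -- v₀`, a cube in the preimage.
    · exfalso
      rcases v with - | ⟨v₀, - | ⟨v₁, v⟩⟩
      · simp at hv
      · simp at hv
      simp only [sub_cons, List.cons_append, List.nil_append, List.cons.injEq] at h
      obtain ⟨rfl, rfl, h⟩ := h
      rcases y with - | ⟨y₀, - | ⟨y₁, y⟩⟩
      · simp at h
      · simp at h
      simp only [sub_cons, List.cons.injEq, flip_flip] at h
      obtain ⟨rfl, rfl, h1, -⟩ := h
      rw [flip_flip] at h1
      exact hy y₀ ⟨[], y, by simp [h1]⟩
    · simp only [sub_cons, List.cons_append, List.cons.injEq] at h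
      obtain ⟨rfl, rfl, h⟩ := h
      obtain ⟨p', q', rfl, hq, rfl⟩ :=
        ih (hy.mono (List.infix_cons List.infix_rfl)) (by simpa using h)
      exact ⟨x :: p', q', rfl, hq, rfl⟩

/-- Each step removes one τ, synchronizing the left copy and then the right copy in what remains.
The intermediate words are cube-free because they are images or short enough from the start. -/
theorem desubstitute_iterate {v : List AB} (hv : 2 ≤ v.length) (m : ℕ) {y p t q : List AB}
    (hy : CubeFree y) (h : sub^[m] y = p ++ sub^[m] v ++ t ++ sub^[m] v ++ q) :
    ∃ p' t' q', t = sub^[m] t' ∧ y = p' ++ v ++ t' ++ v ++ q' := by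
  induction m generalizing p t q with
  | zero => exact ⟨p, t, q, rfl, h⟩
  | succ m ih =>
    rw [Function.iterate_succ_apply', Function.iterate_succ_apply'] at h
    have hm : CubeFree (sub^[m] y) := cubeFree_iterate_sub hy m
    have hl : 2 ≤ (sub^[m] v).length := by
      rw [length_iterate_sub]
      have := Nat.one_le_two_pow (n := m)
      nlinarith
    obtain ⟨p', r, rfl, hr, hy'⟩ := desubstitute (q := t ++ sub (sub^[m] v) ++ q) hm hl
      (by simpa using h)
    have hr' : CubeFree r := hm.mono ⟨p' ++ sub^[m] v, [], by simp [hy']⟩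
    obtain ⟨t', q', rfl, rfl, rfl⟩ := desubstitute hr' hl hr.symm
    obtain ⟨p₀, t₀, q₀, rfl, hy₀⟩ := ih (p := p') (t := t') (q := q') (by simpa using hy')
    exact ⟨p₀, t₀, q₀, by rw [Function.iterate_succ_apply'], hy₀⟩

theorem IsFactor.desubstitute {m : ℕ} {t : List AB}
    (h : IsFactor (sub^[m] [.a, .a] ++ t ++ sub^[m] [.a, .a])) :
    ∃ t', t = sub^[m] t' ∧ IsFactor ([.a, .a] ++ t' ++ [.a, .a]) := by
  obtain ⟨K, hK⟩ := h.eventually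
  obtain ⟨p, q, hpq⟩ := hK (m + K) (by omega)
  rw [Function.iterate_add_apply] at hpq
  obtain ⟨p', t', q', rfl, hy⟩ := desubstitute_iterate (v := [.a, .a]) le_rfl m
    (cubeFree_iterate_sub (cubeFree_singleton .a) K) (p := p) (t := t) (q := q) (by simp [← hpq])
  exact ⟨t', rfl, K, p', q', by simp [hy]⟩

/-! #### Biinfinite sequences -/

/-- The fixed point of `τ ^ 2` obtained from `a.a`. -/
def biinfinite (n : ℤ) : AB :=
  -- Position 0 is the centre of τ^{2m}(aa), at index 4^m. The choice m = |n| is large enough since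
  -- |n| < 4^|n|, so the default letter is never used.
  (sub^[2 * n.natAbs] [.a, .a]).getD (n + 4 ^ n.natAbs).toNat .a

/-- τ²(aa) = abb·aa·bba: each word sits in the middle of the next, shifted by 3·4^m letters, which
is what makes the biinfinite limit consistent. -/
theorem iterate_sub_aa_succ (m : ℕ) : sub^[2 * (m + 1)] [.a, .a] =
    sub^[2 * m] [.a, .b, .b] ++ sub^[2 * m] [.a, .a] ++ sub^[2 * m] [.b, .b, .a] := by
  rw [← iterate_sub_append, ← iterate_sub_append, show 2 * (m + 1) = 2 * m + 2 by ring,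
    Function.iterate_add_apply]
  rfl

theorem length_iterate_sub_aa (m : ℕ) : (sub^[2 * m] [.a, .a]).length = 2 * 4 ^ m := by
  rw [length_iterate_sub, pow_mul]
  norm_num
  ring

theorem getD_iterate_sub_add (n : ℤ) (m k : ℕ) (h1 : -(4 ^ m) ≤ n) (h2 : n < 4 ^ m) :
    (sub^[2 * (m + k)] [.a, .a]).getD (n + 4 ^ (m + k)).toNat .a =
      (sub^[2 * m] [.a, .a]).getD (n + 4 ^ m).toNat .a := by
  induction k with
  | zero => rfl
  | succ k ih =>
    have h3 : (4 : ℤ) ^ m ≤ 4 ^ (m + k) := pow_le_pow_right₀ (by norm_num) (by omega)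
    rw [← ih, ← add_assoc]
    generalize m + k = j at h3
    have e : (n + 4 ^ (j + 1)).toNat = 3 * 4 ^ j + (n + 4 ^ j).toNat := by
      zify
      rw [Int.toNat_of_nonneg (by rw [pow_succ]; linarith), Int.toNat_of_nonneg (by linarith)]
      ring
    have h5 : (n + 4 ^ j).toNat < 2 * 4 ^ j := by
      zify
      rw [Int.toNat_of_nonneg (by linarith)]
      linarith
    have hlen : (sub^[2 * j] [.a, .b, .b]).length = 3 * 4 ^ j := by
      rw [length_iterate_sub, pow_mul]
      norm_num
      ring
    rw [iterate_sub_aa_succ, e, List.append_assoc, List.getD_append_right _ _ _ _ (by omega),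
      hlen, Nat.add_sub_cancel_left,
      List.getD_append _ _ _ _ (by rw [length_iterate_sub_aa]; omega)]

theorem biinfinite_eq (n : ℤ) (m : ℕ) (h1 : -(4 ^ m) ≤ n) (h2 : n < 4 ^ m) :
    biinfinite n = (sub^[2 * m] [.a, .a]).getD (n + 4 ^ m).toNat .a := by
  have h : |n| < 4 ^ n.natAbs := by
    rw [← Int.natCast_natAbs]
    exact_mod_cast Nat.lt_pow_self (by norm_num)
  obtain ⟨h3, h4⟩ := abs_lt.1 h
  rw [biinfinite, ← getD_iterate_sub_add n n.natAbs m h3.le h4, add_comm,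
    getD_iterate_sub_add n m _ h1 h2]

theorem map_biinfinite (m : ℕ) (n : ℤ) (l : ℕ) (h1 : -(4 ^ m) ≤ n) (h2 : n + l ≤ 4 ^ m) :
    (List.range l).map (fun i : ℕ => biinfinite (n + i)) =
      ((sub^[2 * m] [.a, .a]).drop (n + 4 ^ m).toNat).take l := by
  have hlen := length_iterate_sub_aa m
  have hn : ((n + 4 ^ m).toNat : ℤ) = n + 4 ^ m := Int.toNat_of_nonneg (by linarith)
  have hl : (n + 4 ^ m).toNat + l ≤ 2 * 4 ^ m := by
    zify
    rw [hn]
    linarith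
  refine List.ext_getElem (by simp; omega) fun i hi hi' => ?_
  have hil : i < l := by simpa using hi
  have hil' : (i : ℤ) < l := by exact_mod_cast hil
  have e : (n + i + 4 ^ m).toNat = (n + 4 ^ m).toNat + i := by
    zify
    rw [hn, Int.toNat_of_nonneg (by linarith)]
    ring
  simp only [List.getElem_map, List.getElem_range, List.getElem_take, List.getElem_drop]
  rw [biinfinite_eq _ m (by linarith) (by linarith), e, List.getD_eq_getElem]

theorem mem_language_iff (w : FreeSemigroup AB) :
    w ∈ thueMorse.language ↔ IsFactor w.letters := by
  constructor
  · intro h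
    obtain ⟨k, -, x, hx⟩ := h 0
    rw [letters_iterate_thueMorse] at hx
    exact ((isFactor_singleton x).iterate_sub k).mono hx
  · intro h N
    obtain ⟨K, hK⟩ := h.eventually
    refine ⟨max K N, le_max_right _ _, .a, ?_⟩
    rw [letters_iterate_thueMorse]
    exact hK _ (le_max_left _ _)

theorem isFactor_iterate_sub_aa (m : ℕ) : IsFactor (sub^[m] [.a, .a]) :=
  isFactor_aa.iterate_sub m

/-- In `Substitution.IsBlock` the whole list of naturals is coerced to integers through the list
monad; here the cast is moved inside the function. -/
theorem isBlock_iff {A : Type u} (x : ℤ → A) (w : FreeSemigroup A) :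
    Substitution.IsBlock x w ↔
      ∃ n : ℤ, w.letters = (List.range w.letters.length).map fun i : ℕ => x (n + i) := by
  have h : ∀ l : List ℕ, (do let i ← l; pure (i : ℤ)) = l.map Nat.cast := fun l =>
    (List.map_eq_flatMap).symm
  unfold Substitution.IsBlock
  simp only [h, List.map_map]
  rfl

theorem biinfinite_mem_subshift : biinfinite ∈ thueMorse.subshift := by
  intro w hw
  obtain ⟨n, hn⟩ := (isBlock_iff _ _).1 hw
  rw [mem_language_iff]
  have h : n.natAbs + w.letters.length < 4 ^ (n.natAbs + w.letters.length) :=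
    Nat.lt_pow_self (by norm_num)
  have h' : |n| + w.letters.length < 4 ^ (n.natAbs + w.letters.length) := by
    rw [← Int.natCast_natAbs]
    exact_mod_cast h
  have h1 := neg_abs_le n
  have h2 := le_abs_self n
  rw [map_biinfinite (n.natAbs + w.letters.length) n _ (by linarith) (by linarith)] at hn
  rw [hn]
  exact (isFactor_iterate_sub_aa _).mono
    ((List.take_prefix _ _).isInfix.trans (List.drop_suffix _ _).isInfix)

/-- The finite blocks of the Thue–Morse subshift are the factors of the words `τ ^ k (a)`. -/
theorem mem_blocks_iff (w : FreeSemigroup AB) : w ∈ thueMorse.blocks ↔ IsFactor w.letters := by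
  constructor
  · rintro ⟨x, hx, hw⟩
    exact (mem_language_iff w).1 (hx w hw)
  · intro h
    refine ⟨biinfinite, biinfinite_mem_subshift, ?_⟩
    obtain ⟨K, hK⟩ := h.eventually
    obtain ⟨p, q, hpq⟩ := hK (2 * K) (by omega)
    have hlen : p.length + w.letters.length + q.length = 4 ^ K := by
      have := congrArg List.length hpq
      rw [length_iterate_sub, pow_mul] at this
      simpa [add_assoc] using this
    have hlen' : (p.length + w.letters.length + q.length : ℤ) = 4 ^ K := by exact_mod_cast hlen
    refine (isBlock_iff _ _).2 ⟨p.length - 4 ^ K, ?_⟩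
    rw [map_biinfinite K _ _ (by linarith) (by
        have : (0 : ℤ) ≤ 4 ^ K := by positivity
        linarith)]
    rw [show [AB.a, AB.a] = [.a] ++ [.a] from rfl, iterate_sub_append, ← hpq]
    simp

/-! #### Short factors -/

/-- The blocks τ^k(x) have length 2^k. A window of length at most 2^k + 1 that starts inside the
first block ends no later than the second; otherwise the first block can be dropped. -/
theorem infix_iterate_sub_pair {k : ℕ} {l : List AB} (hl : l.length ≤ 2 ^ k + 1) (x y : AB)
    {z p q : List AB} (h : p ++ l ++ q = sub^[k] (x :: y :: z)) :
    ∃ x' y', l <:+: sub^[k] [x', y'] := by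
  induction z generalizing x y p with
  | nil => exact ⟨x, y, p, q, h⟩
  | cons t z ih =>
    have hx := length_iterate_sub k [x]
    have hxy := length_iterate_sub k [x, y]
    simp only [List.length_cons, List.length_nil] at hx hxy
    by_cases hp : 2 ^ k ≤ p.length
    · rw [show x :: y :: t :: z = [x] ++ (y :: t :: z) from rfl, iterate_sub_append,
        List.append_assoc] at h
      obtain ⟨p', hp'⟩ := List.prefix_of_prefix_length_le (List.prefix_append _ _)
        (h ▸ List.prefix_append p (l ++ q)) (by omega : (sub^[k] [x]).length ≤ p.length)
      rw [← hp', List.append_assoc, List.append_cancel_left_eq] at h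
      exact ih y t (p := p') (by simpa using h)
    · refine ⟨x, y, p, ?_⟩
      rw [show x :: y :: t :: z = [x, y] ++ (t :: z) from rfl, iterate_sub_append] at h
      exact List.prefix_of_prefix_length_le (h ▸ List.prefix_append (p ++ l) q)
        (List.prefix_append _ _) (by simp; omega)

theorem IsFactor.infix_pair {k : ℕ} {l : List AB} (h : IsFactor l) (hl : l.length ≤ 2 ^ k + 1) :
    ∃ x y, l <:+: sub^[k] [x, y] := by
  obtain ⟨K, hK⟩ := h.eventually
  obtain ⟨p, q, hpq⟩ := hK (k + (K + 1)) (by omega)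
  have h2 := length_iterate_sub (K + 1) [.a]
  rw [Function.iterate_add_apply] at hpq
  rcases hz : sub^[K + 1] [.a] with - | ⟨x, - | ⟨y, z⟩⟩
  · rw [hz] at h2
    simp only [List.length_nil, List.length_cons] at h2
    have := Nat.one_le_two_pow (n := K + 1)
    omega
  · rw [hz] at h2
    simp only [List.length_nil, List.length_cons, pow_succ] at h2
    omega
  · rw [hz] at hpq
    exact infix_iterate_sub_pair hl x y hpq

end ThueMorse

namespace ThueMorse

/-! ### The return words of `aa` -/

/-- The words that start and end with `a`. -/
structure StartsEndsWithA (l : List AB) : Prop where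
  prefix_a : [.a] <+: l
  suffix_a : [.a] <:+ l

/-- The words that start and end with `a` and do not contain `aa`. -/
structure IsPiece (l : List AB) : Prop extends StartsEndsWithA l where
  not_infix : ¬ [.a, .a] <:+: l

theorem StartsEndsWithA.ne_nil {l : List AB} (h : StartsEndsWithA l) : l ≠ [] := by
  rintro rfl
  simpa using h.prefix_a

theorem StartsEndsWithA.iterate_sub {l : List AB} (h : StartsEndsWithA l) (k : ℕ) :
    StartsEndsWithA (sub^[2 * k] l) := by
  obtain ⟨⟨s, hs⟩, ⟨t, ht⟩⟩ := h
  constructor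
  · rw [← hs, iterate_sub_append]
    exact (iterate_sub_prefix (Nat.zero_le _)).trans (List.prefix_append _ _)
  · rw [← ht, iterate_sub_append]
    exact (iterate_sub_suffix (Nat.zero_le _)).trans (List.suffix_append _ _)

/-- Were `l ++ [.a]` a proper prefix, it would be a prefix of `m`; as `l` ends with a, this would
put aa inside `m`. -/
theorem IsPiece.eq_of_prefix {l m : List AB} (hl : IsPiece l) (hm : IsPiece m)
    (h : l ++ [.a] <+: m ++ [.a]) : l = m := by
  rcases List.prefix_concat_iff.1 h with h | h
  · simpa using h
  · obtain ⟨l', rfl⟩ := hl.suffix_a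
    refine absurd ?_ hm.not_infix
    obtain ⟨s, hs⟩ := h
    exact ⟨l', s, by simpa using hs⟩

/-- For a return word v with v·aa = a·l·a, an occurrence of aa that is neither initial nor final is
exactly an occurrence inside l. -/
theorem isPiece_iff_occurrences (l : List AB) (h : StartsEndsWithA l) :
    IsPiece l ↔ ∀ p s : List AB, .a :: l ++ [.a] = p ++ [.a, .a] ++ s → p = [] ∨ s = [] := by
  constructor
  · intro hl p s e
    by_contra! hps
    obtain ⟨hp, hs⟩ := hps
    obtain ⟨x, p, rfl⟩ := List.exists_cons_of_ne_nil hp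
    rcases List.eq_nil_or_concat s with rfl | ⟨s, y, rfl⟩
    · exact hs rfl
    refine hl.not_infix ⟨p, s, ?_⟩
    have e' : l ++ [.a] = (p ++ [.a, .a] ++ s) ++ [y] := by simpa using (List.cons.inj e).2
    exact (List.append_inj' e' rfl).1.symm
  · intro H
    refine ⟨h, ?_⟩
    rintro ⟨p, s, rfl⟩
    rcases H (.a :: p) (s ++ [.a]) (by simp) with h | h <;> simp at h

theorem mem_returnSet_iff (x : FreeSemigroup AB) : x ∈ thueMorse.returnSet .a .a ↔
    IsPiece x.letters ∧ IsFactor (.a :: x.letters ++ [.a]) := by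
  have haa : (FreeSemigroup.of AB.a * FreeSemigroup.of AB.a).letters = [.a, .a] := rfl
  constructor
  · rintro ⟨v, ⟨hv1, hv2, hv3⟩, hx⟩
    have e : .a :: x.letters = v.letters ++ [.a] := congrArg FreeSemigroup.letters hx
    rw [mem_blocks_iff] at hv1
    rw [FreeSemigroup.letters_mul v, haa] at hv1 hv2 hv3
    have e' : v.letters ++ [.a, .a] = .a :: x.letters ++ [.a] := by rw [e]; simp
    rw [e'] at hv1 hv2 hv3
    have hs : StartsEndsWithA x.letters := by
      constructor
      · obtain ⟨s, hs⟩ := hv2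
        have hs : .a :: s = x.letters ++ [.a] := by simpa using hs
        obtain ⟨y, l, hl⟩ := List.exists_cons_of_ne_nil x.letters_ne_nil
        rw [hl] at hs ⊢
        rw [(List.cons.inj hs).1]
        exact ⟨l, rfl⟩
      · rcases List.eq_nil_or_concat x.letters with h | ⟨s, y, h⟩
        · exact absurd h x.letters_ne_nil
        · rw [List.concat_eq_append] at h
          rw [h, ← List.cons_append] at e
          rw [h, (List.cons.inj (List.append_inj' e rfl).2).1]
          exact ⟨s, rfl⟩
    exact ⟨(isPiece_iff_occurrences _ hs).2 hv3, hv1⟩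
  · rintro ⟨h1, h2⟩
    obtain ⟨s, hs⟩ := h1.suffix_a
    have e' : (FreeSemigroup.letters ⟨.a, s⟩) ++ [.a, .a] = .a :: x.letters ++ [.a] := by
      rw [← hs]
      simp [FreeSemigroup.letters]
    refine ⟨⟨.a, s⟩, ⟨?_, ?_, ?_⟩, ?_⟩
    · rw [mem_blocks_iff, FreeSemigroup.letters_mul, haa, e']
      exact h2
    · rw [FreeSemigroup.letters_mul ⟨.a, s⟩, haa, e']
      obtain ⟨t, ht⟩ := h1.prefix_a
      exact ⟨t ++ [.a], by simp [← ht]⟩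
    · rw [FreeSemigroup.letters_mul, haa, e']
      exact (isPiece_iff_occurrences _ h1.1).1 h1
    · apply FreeSemigroup.letters_injective
      rw [FreeSemigroup.letters_mul, FreeSemigroup.letters_mul, ← hs]
      rfl

/-- The elements of `a⁻¹ R(aa) a`, as lists. -/
def pieces : List (List AB) :=
  [[.a, .b, .b, .a], [.a, .b, .a, .b, .b, .a], [.a, .b, .b, .a, .b, .a],
    [.a, .b, .a, .b, .b, .a, .b, .a]]

theorem isPiece_of_mem_pieces {r : List AB} (h : r ∈ pieces) :
    IsPiece r ∧ IsFactor (.a :: r ++ [.a]) := by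
  have key : ∀ r ∈ pieces, ([.a] <+: r ∧ [.a] <:+ r) ∧ ¬ [.a, .a] <:+: r ∧
    .a :: r ++ [.a] <:+: sub^[6] [.a] := by decide +kernel
  obtain ⟨⟨h1, h2⟩, h3, h4⟩ := key r h
  exact ⟨⟨⟨h1, h2⟩, h3⟩, 6, h4⟩

/-- The words τ⁴(xy) have 32 letters, hence 33 offsets. From an occurrence of aa, either a known
return is completed inside the word, or the right end comes within fewer than 17 letters and before
any further aa. -/
theorem occurrence_aa_in_pair : ∀ x ∈ [AB.a, .b], ∀ y ∈ [AB.a, .b], ∀ i ∈ List.range 33,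
    [.a, .a] <+: (sub^[4] [x, y]).drop i →
      (∃ r ∈ pieces, .a :: r ++ [.a] <+: (sub^[4] [x, y]).drop i) ∨
      ((sub^[4] [x, y]).drop i).length < 17 ∧ ¬ [.a, .a] <:+: ((sub^[4] [x, y]).drop i).tail := by
  decide +kernel

theorem mem_pieces {l : List AB} (h : IsPiece l) (hf : IsFactor (.a :: l ++ [.a])) :
    l ∈ pieces := by
  set u : List AB := .a :: l ++ [.a] with hu
  obtain ⟨t, ht⟩ := h.prefix_a
  obtain ⟨t', ht'⟩ := h.suffix_a
  -- 17 = 2⁴ + 1 is the window that fits into some τ⁴(xy). Truncating to it avoids any prior bound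
  -- on the length of u.
  obtain ⟨x, y, p, s, hps⟩ := (hf.mono (List.take_prefix 17 u).isInfix).infix_pair (k := 4)
    (List.length_take_le _ _)
  have hmem : ∀ x : AB, x ∈ [AB.a, .b] := by rintro (_ | _) <;> simp
  have hlen : p.length < 33 := by
    have := congrArg List.length hps
    rw [length_iterate_sub] at this
    simp only [List.length_append, List.length_cons, List.length_nil] at this
    omega
  have hdrop : (sub^[4] [x, y]).drop p.length = u.take 17 ++ s := by
    rw [← hps]
    simp
  have hu' : u.take 17 <+: (sub^[4] [x, y]).drop p.length := hdrop ▸ List.prefix_append _ _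
  have haa : [.a, .a] <+: u.take 17 := by
    rw [hu, ← ht]
    exact ⟨(t ++ [AB.a]).take 15, by simp⟩
  rcases occurrence_aa_in_pair x (hmem x) y (hmem y) p.length (List.mem_range.2 hlen)
    (haa.trans hu') with ⟨r, hr, hr'⟩ | ⟨h1, h2⟩
  · have hr1 := (isPiece_of_mem_pieces hr).1
    -- A known return with its flanks has at most 10 letters, so if the window is a prefix of it,
    -- the window is all of u.
    have hcomp : .a :: r ++ [.a] <+: u ∨ u <+: .a :: r ++ [.a] := by
      rcases List.prefix_or_prefix_of_prefix hr' hu' with h | h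
      · exact Or.inl (h.trans (List.take_prefix _ _))
      · have h10 : r.length ≤ 8 := (by decide : ∀ r ∈ pieces, r.length ≤ 8) r hr
        have hle := h.length_le
        simp only [List.length_take, List.cons_append, List.length_cons, List.length_append,
          List.length_nil] at hle
        rw [List.take_of_length_le (by omega)] at h
        exact Or.inr h
    rcases hcomp with h' | h'
    · rw [hu, List.cons_append, List.cons_append, List.cons_prefix_cons] at h'
      exact hr1.eq_of_prefix h h'.2 ▸ hr
    · rw [hu, List.cons_append, List.cons_append, List.cons_prefix_cons] at h'
      exact h.eq_of_prefix hr1 h'.2 ▸ hr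
  -- With fewer than 17 letters left, u was not truncated, and its final aa is the occurrence that
  -- `h2` forbids.
  · refine absurd ?_ h2
    have hle := hu'.length_le
    simp only [List.length_take] at hle
    rw [hdrop, List.take_of_length_le (by omega), hu, ← ht']
    exact ⟨t', s, by simp⟩

theorem returnSet_eq : thueMorse.returnSet AB.a AB.a =
    {AB.word .a [.b, .b, .a], AB.word .a [.b, .a, .b, .b, .a],
      AB.word .a [.b, .b, .a, .b, .a], AB.word .a [.b, .a, .b, .b, .a, .b, .a]} := by
  ext x
  have h1 : x ∈ thueMorse.returnSet AB.a AB.a ↔ x.letters ∈ pieces := by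
    rw [mem_returnSet_iff]
    exact ⟨fun h => mem_pieces h.1 h.2, isPiece_of_mem_pieces⟩
  rw [h1]
  obtain ⟨y, l⟩ := x
  simp [pieces, FreeSemigroup.letters, AB.word, FreeSemigroup.ext_iff]

/-! ### Decompositions over the return words -/

/-- Pieces start and end with a, so each seam creates an aa, and no piece contains one. If a first
factor were a proper prefix of the other, the seam after it would put aa inside the longer piece. -/
theorem eq_of_flatten_eq {L M : List (List AB)} (hL : ∀ l ∈ L, IsPiece l)
    (hM : ∀ l ∈ M, IsPiece l) (h : L.flatten = M.flatten) : L = M := by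
  have key : ∀ {x y : List AB} {L M : List (List AB)}, IsPiece x → IsPiece y →
      (∀ l ∈ L, IsPiece l) → x ++ L.flatten = y ++ M.flatten → x <+: y → x = y := by
    rintro x y L M hx hy hL h ⟨z, rfl⟩
    rw [List.append_assoc, List.append_cancel_left_eq] at h
    rcases z with - | ⟨c, z⟩
    · simp
    exfalso
    rcases L with - | ⟨l, L⟩
    · simp at h
    obtain ⟨l', hl'⟩ := (hL l (by simp)).prefix_a
    obtain ⟨x', rfl⟩ := hx.suffix_a
    rw [List.flatten_cons, ← hl'] at h
    simp only [List.cons_append, List.cons.injEq] at h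
    exact hy.not_infix ⟨x', z, by simp [← h.1]⟩
  induction L generalizing M with
  | nil =>
    cases M with
    | nil => rfl
    | cons y M => exact absurd (List.append_eq_nil_iff.1 h.symm).1 (hM y (by simp)).ne_nil
  | cons x L ih =>
    cases M with
    | nil => exact absurd (List.append_eq_nil_iff.1 h).1 (hL x (by simp)).ne_nil
    | cons y M =>
      simp only [List.mem_cons, forall_eq_or_imp] at hL hM
      rw [List.flatten_cons, List.flatten_cons] at h
      have hxy : x = y := by
        rcases List.prefix_or_prefix_of_prefix (List.prefix_append x L.flatten)
          (h ▸ List.prefix_append y M.flatten) with h' | h'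
        · exact key hL.1 hM.1 hL.2 h h'
        · exact (key hM.1 hL.1 hM.2 h.symm h').symm
      subst hxy
      rw [ih hL.2 hM.2 (List.append_cancel_left h)]

/-- The set `a⁻¹ R(aa) a`. -/
abbrev X : Set (FreeSemigroup AB) := thueMorse.returnSet .a .a

theorem letters_wordInclusion {A : Type u} (Y : Set (FreeSemigroup A)) (v : FreeSemigroup Y) :
    (wordInclusion Y v).letters = (v.letters.map fun y => y.1.letters).flatten := by
  induction v using FreeSemigroup.recOnMul with
  | ih1 x =>
    rw [FreeSemigroup.letters_of]
    simp [wordInclusion]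
  | ih2 x w h1 h2 =>
    rw [map_mul, FreeSemigroup.letters_mul, FreeSemigroup.letters_mul, h1, h2, List.map_append,
      List.flatten_append]

theorem isPiece_letters (x : X) : IsPiece x.1.letters := ((mem_returnSet_iff x.1).1 x.2).1

theorem map_letters_eq_of_flatten_eq {L M : List X}
    (h : (L.map fun y => y.1.letters).flatten = (M.map fun y => y.1.letters).flatten) :
    L = M := by
  refine List.map_injective_iff.2 (FreeSemigroup.letters_injective.comp Subtype.val_injective)
    (eq_of_flatten_eq ?_ ?_ h)
  all_goals
    intro l hl
    obtain ⟨y, -, rfl⟩ := List.mem_map.1 hl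
    exact isPiece_letters y

/-- The set `a⁻¹ R(aa) a` is a code. -/
theorem wordInclusion_injective : Function.Injective (wordInclusion X) := by
  intro v w h
  apply FreeSemigroup.letters_injective
  apply map_letters_eq_of_flatten_eq
  rw [← letters_wordInclusion, ← letters_wordInclusion, h]

/-- Cutting between the two letters of an occurrence of aa leaves two shorter words that again start
and end with a and are flanked by a's in a block. A word without aa is itself in X. -/
theorem exists_decomposition (y : FreeSemigroup AB) (hy : StartsEndsWithA y.letters)
    (hf : IsFactor (.a :: y.letters ++ [.a])) : ∃ v : FreeSemigroup X, wordInclusion X v = y := by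
  induction hn : y.letters.length using Nat.strong_induction_on generalizing y with
  | _ n ih =>
    by_cases haa : [.a, .a] <:+: y.letters
    · obtain ⟨p, s, hps⟩ := haa
      obtain ⟨y₁, hy₁⟩ := FreeSemigroup.exists_letters_eq (l := p ++ [AB.a]) (by simp)
      obtain ⟨y₂, hy₂⟩ := FreeSemigroup.exists_letters_eq (l := AB.a :: s) (by simp)
      have e : y = y₁ * y₂ := FreeSemigroup.letters_injective (by
        rw [FreeSemigroup.letters_mul, hy₁, hy₂, ← hps]
        simp)
      have hlen : p.length + 2 + s.length = n := by
        rw [← hn, ← hps]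
        simp
        ring
      rw [← hps] at hf
      have h₁ : StartsEndsWithA y₁.letters := by
        refine ⟨List.prefix_of_prefix_length_le hy.1 ?_ ?_, ?_⟩
        · rw [← hps, hy₁]
          exact ⟨.a :: s, by simp⟩
        · simp [hy₁]
        · rw [hy₁]
          exact ⟨p, rfl⟩
      have h₂ : StartsEndsWithA y₂.letters := by
        refine ⟨?_, List.suffix_of_suffix_length_le hy.2 ?_ ?_⟩
        · rw [hy₂]
          exact ⟨s, rfl⟩
        · rw [← hps, hy₂]
          exact ⟨p ++ [.a], by simp⟩
        · simp [hy₂]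
      obtain ⟨v₁, hv₁⟩ := ih _ (by rw [hy₁]; simp; omega) y₁ h₁ (hf.mono (by
        rw [hy₁]
        exact ⟨[], s ++ [.a], by simp⟩)) rfl
      obtain ⟨v₂, hv₂⟩ := ih _ (by rw [hy₂]; simp; omega) y₂ h₂ (hf.mono (by
        rw [hy₂]
        exact ⟨.a :: p, [], by simp⟩)) rfl
      exact ⟨v₁ * v₂, by rw [map_mul, hv₁, hv₂, e]⟩
    · exact ⟨FreeSemigroup.of ⟨y, (mem_returnSet_iff y).2 ⟨⟨hy, haa⟩, hf⟩⟩, rfl⟩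

theorem exists_decomposition_thueMorse_sq (x : X) :
    ∃ v : FreeSemigroup X, wordInclusion X v = thueMorse (thueMorse x) := by
  obtain ⟨h1, h2⟩ := (mem_returnSet_iff x.1).1 x.2
  have e : (thueMorse (thueMorse x)).letters = sub^[2 * 1] x.1.letters := by
    rw [letters_thueMorse, letters_thueMorse]
    rfl
  apply exists_decomposition
  · rw [e]
    exact h1.1.iterate_sub 1
  · refine (h2.iterate_sub 2).mono ?_
    rw [e, show AB.a :: x.1.letters ++ [.a] = [.a] ++ x.1.letters ++ [.a] from rfl,
      iterate_sub_append, iterate_sub_append]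
    -- τ²(a x a) = abb·a τ²(x) a·bba. The square of τ is needed because τ(a) does not end with a.
    exact ⟨[.a, .b, .b], [.b, .b, .a], by simp [flip]⟩

instance : Finite X := by
  rw [X, returnSet_eq]
  infer_instance

end ThueMorse

/-! ### Topology of the free profinite semigroup -/

/-! ### Iterates and ω-powers seen through finite sets. -/

theorem exists_iterate_mul_eq {Q : Type u} [Finite Q] (T : Q → Q) (q : Q) :
    ∃ N > 0, ∀ k > 0, T^[N * k] q = T^[N] q := by
  obtain ⟨i, j, hij, h⟩ := Finite.exists_ne_map_eq_of_infinite fun n : ℕ => T^[n] q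
  wlog hlt : i < j generalizing i j
  · exact this j i hij.symm h.symm (by omega)
  have hp : Function.IsPeriodicPt T (j - i) (T^[i] q) := by
    change T^[j - i] (T^[i] q) = T^[i] q
    rw [← Function.iterate_add_apply, Nat.sub_add_cancel hlt.le]
    exact h.symm
  have hN : i ≤ (j - i) * (i + 1) := by
    have : 1 ≤ j - i := by omega
    nlinarith
  -- N is a multiple of the period j - i and at least the preperiod i, so further multiples of N
  -- change nothing.
  refine ⟨(j - i) * (i + 1), by apply Nat.mul_pos <;> omega, fun k hk => ?_⟩
  generalize hN' : (j - i) * (i + 1) = N at hN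
  have hp' : Function.IsPeriodicPt T N (T^[N] q) := by
    have := (hp.apply_iterate (N - i)).mul_const (i + 1)
    rwa [hN', ← Function.iterate_add_apply, Nat.sub_add_cancel hN] at this
  obtain ⟨k, rfl⟩ := Nat.exists_eq_succ_of_ne_zero hk.ne'
  rw [Nat.mul_succ, Function.iterate_add_apply]
  exact hp'.mul_const k

/-- Precomposition with `f` is a self-map of the finite set `F`; working there makes N independent
of the point of `S`. -/
theorem exists_comp_iterate_mul_eq {S : Type u} {Q : Type v} (f : S → S) (F : Set (S → Q))
    (hF : F.Finite) (hf : ∀ θ ∈ F, θ ∘ f ∈ F) (θ : S → Q) (hθ : θ ∈ F) :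
    ∃ N > 0, ∀ k > 0, θ ∘ f^[N * k] = θ ∘ f^[N] := by
  have : Finite F := hF
  let T : F → F := fun θ => ⟨θ.1 ∘ f, hf _ θ.2⟩
  have hT : ∀ n (η : F), (T^[n] η).1 = η.1 ∘ f^[n] := by
    intro n
    induction n with
    | zero => intro η; rfl
    | succ n ih =>
      intro η
      rw [Function.iterate_succ_apply, ih, Function.iterate_succ']
      rfl
  obtain ⟨N, hN, h⟩ := exists_iterate_mul_eq T ⟨θ, hθ⟩
  refine ⟨N, hN, fun k hk => ?_⟩
  have := congrArg Subtype.val (h k hk)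
  rwa [hT, hT] at this

/-- A continuous map with finitely many iterated compositions evaluates `f ^ ω` as a power of
`f`. -/
theorem exists_comp_omegaPower_eq {S : Type u} [TopologicalSpace S] {Q : Type v} (f : S → S)
    (hlim : ∀ x, Tendsto (fun n : ℕ => f^[n.factorial] x) atTop (𝓝 (omegaPower f x)))
    (F : Set (S → Q)) (hF : F.Finite) (hf : ∀ θ ∈ F, θ ∘ f ∈ F) (θ : S → Q) (hθ : θ ∈ F)
    (hc : IsLocallyConstant θ) :
    ∃ N > 0, ∀ k > 0, ∀ x, θ (omegaPower f x) = θ (f^[N * k] x) := by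
  obtain ⟨N, hN, h⟩ := exists_comp_iterate_mul_eq f F hF hf θ hθ
  refine ⟨N, hN, fun k hk x => ?_⟩
  have h1 : ∀ᶠ n : ℕ in atTop, θ (f^[n.factorial] x) = θ (omegaPower f x) :=
    (hlim x).eventually (hc.eventually_eq _)
  obtain ⟨n, hn, hn'⟩ := (h1.and (eventually_ge_atTop N)).exists
  obtain ⟨m, hm⟩ := Nat.dvd_factorial hN hn'
  have hm' : 0 < m := by
    rcases Nat.eq_zero_or_pos m with rfl | h
    · exact absurd hm (by simpa using Nat.factorial_ne_zero n)
    · exact h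
  rw [← hn, hm]
  exact (congrFun (h m hm') x).trans (congrFun (h k hk) x).symm

namespace FreeProfiniteSemigroup

variable {A : Type u}

/-! ### Profinite topology and coordinates. -/

theorem ext_coord {x y : FreeProfiniteSemigroup A} (h : ∀ c : FiniteCon A, x.1 c = y.1 c) :
    x = y :=
  Subtype.ext (funext h)

theorem liftFun_mkMulHom (c : FiniteCon A) [Finite c.1.Quotient] (x : FreeProfiniteSemigroup A) :
    liftFun c.1.mkMulHom x = x.1 c := by
  obtain ⟨w, hw⟩ := exists_word x c
  rw [hw]
  exact liftFun_eq c.1.mkMulHom x c (fun {s t} h => (Con.eq _).2 h) w hw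

theorem isEmbedding_coord : @IsEmbedding _ _ _
    (@Pi.topologicalSpace (FiniteCon A) (fun c => c.1.Quotient) fun _ => ⊥)
    (fun (x : FreeProfiniteSemigroup A) (c : FiniteCon A) => x.1 c) :=
  @IsEmbedding.mk _ _ _ (_) _ (@IsInducing.mk _ _ _ (_) _ rfl) fun _ _ h => ext_coord (congrFun h)

theorem isClosed_range_coord : @IsClosed _
    (@Pi.topologicalSpace (FiniteCon A) (fun c => c.1.Quotient) fun _ => ⊥)
    (Set.range fun (x : FreeProfiniteSemigroup A) (c : FiniteCon A) => x.1 c) := by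
  let _ : ∀ c : FiniteCon A, TopologicalSpace c.1.Quotient := fun _ => ⊥
  have : ∀ c : FiniteCon A, DiscreteTopology c.1.Quotient := fun _ => ⟨rfl⟩
  have h : (Set.range fun (x : FreeProfiniteSemigroup A) (c : FiniteCon A) => x.1 c) =
      ⋂ (c : FiniteCon A) (d : FiniteCon A) (_ : c.1 ≤ d.1) (w : FreeSemigroup A),
        {f | f c = (w : c.1.Quotient) → f d = (w : d.1.Quotient)} := by
    ext f
    simp only [Set.mem_iInter, Set.mem_range, Set.mem_ofPred_eq]
    exact ⟨fun ⟨x, hx⟩ => hx ▸ x.2, fun hf => ⟨⟨f, hf⟩, rfl⟩⟩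
  rw [h]
  refine isClosed_iInter fun c => isClosed_iInter fun d => isClosed_iInter fun _ =>
    isClosed_iInter fun w => ?_
  have e : {f : ∀ c : FiniteCon A, c.1.Quotient |
      f c = (w : c.1.Quotient) → f d = (w : d.1.Quotient)} =
      (fun f => f c) ⁻¹' {(w : c.1.Quotient)}ᶜ ∪ (fun f => f d) ⁻¹' {(w : d.1.Quotient)} := by
    ext f
    simp only [Set.mem_ofPred_eq, Set.mem_union, Set.mem_preimage, Set.mem_compl_iff,
      Set.mem_singleton_iff]
    tauto
  rw [e]
  exact ((isClosed_discrete _).preimage (continuous_apply c)).union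
    ((isClosed_discrete _).preimage (continuous_apply d))

instance : T2Space (FreeProfiniteSemigroup A) := by
  let _ : ∀ c : FiniteCon A, TopologicalSpace c.1.Quotient := fun _ => ⊥
  have : ∀ c : FiniteCon A, DiscreteTopology c.1.Quotient := fun _ => ⟨rfl⟩
  exact isEmbedding_coord.t2Space

instance : CompactSpace (FreeProfiniteSemigroup A) := by
  let _ : ∀ c : FiniteCon A, TopologicalSpace c.1.Quotient := fun _ => ⊥
  have : ∀ c : FiniteCon A, Finite c.1.Quotient := fun c => c.2
  exact (IsClosedEmbedding.mk isEmbedding_coord isClosed_range_coord).compactSpace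

instance : TotallyDisconnectedSpace (FreeProfiniteSemigroup A) := by
  let _ : ∀ c : FiniteCon A, TopologicalSpace c.1.Quotient := fun _ => ⊥
  have : ∀ c : FiniteCon A, DiscreteTopology c.1.Quotient := fun _ => ⟨rfl⟩
  exact ⟨isEmbedding_coord.isTotallyDisconnected
    (isTotallyDisconnected_of_totallyDisconnectedSpace _)⟩

instance : ContinuousMul (FreeProfiniteSemigroup A) := by
  let _ : ∀ c : FiniteCon A, TopologicalSpace c.1.Quotient := fun _ => ⊥
  have : ∀ c : FiniteCon A, DiscreteTopology c.1.Quotient := fun _ => ⟨rfl⟩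
  have hc : Continuous fun (x : FreeProfiniteSemigroup A) (c : FiniteCon A) => x.1 c :=
    isEmbedding_coord.continuous
  refine ⟨continuous_induced_rng.2 (continuous_pi fun c => ?_)⟩
  have h1 : Continuous fun p : FreeProfiniteSemigroup A × FreeProfiniteSemigroup A =>
      (p.1.1 c, p.2.1 c) :=
    (((continuous_apply c).comp hc).comp continuous_fst).prodMk
      (((continuous_apply c).comp hc).comp continuous_snd)
  exact (continuous_of_discreteTopology
    (f := fun q : c.1.Quotient × c.1.Quotient => q.1 * q.2)).comp h1

theorem isLocallyConstant_coord (c : FiniteCon A) :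
    IsLocallyConstant fun x : FreeProfiniteSemigroup A => x.1 c := by
  let _ : ∀ c : FiniteCon A, TopologicalSpace c.1.Quotient := fun _ => ⊥
  have : ∀ c : FiniteCon A, DiscreteTopology c.1.Quotient := fun _ => ⟨rfl⟩
  exact (IsLocallyConstant.iff_continuous _).2
    ((continuous_apply c).comp (isEmbedding_coord (A := A)).continuous)

theorem isLocallyConstant_liftFun {Q : Type v} [Mul Q] [Finite Q] (θ : FreeSemigroup A →ₙ* Q) :
    IsLocallyConstant (liftFun θ) :=
  (isLocallyConstant_coord ⟨Con.ker θ, finite_ker_quotient θ⟩).comp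
    fun q : (Con.ker θ).Quotient => Con.liftOn q θ fun _ _ h => h

/-- The coordinates form a neighbourhood basis. -/
theorem exists_con_of_isOpen {U : Set (FreeProfiniteSemigroup A)} (hU : IsOpen U)
    {x : FreeProfiniteSemigroup A} (hx : x ∈ U) :
    ∃ c : FiniteCon A, ∀ y : FreeProfiniteSemigroup A, y.1 c = x.1 c → y ∈ U := by
  let _ : ∀ c : FiniteCon A, TopologicalSpace c.1.Quotient := fun _ => ⊥
  obtain ⟨V, hV, rfl⟩ := isOpen_induced_iff.1 hU
  obtain ⟨I, u, hu, hI⟩ := isOpen_pi_iff.1 hV _ hx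
  have : ∀ d : I, Finite d.1.1.Quotient := fun d => d.1.2
  let θ : FreeSemigroup A →ₙ* ∀ d : I, d.1.1.Quotient :=
    { toFun := fun w d => (w : d.1.1.Quotient)
      map_mul' := fun _ _ => rfl }
  refine ⟨⟨Con.ker θ, finite_ker_quotient θ⟩, fun y hy => hI fun d hd => ?_⟩
  obtain ⟨w, hw⟩ := exists_word x ⟨Con.ker θ, finite_ker_quotient θ⟩
  have hle : Con.ker θ ≤ d.1 := fun {s t} h => (Con.eq _).1 (congrFun h ⟨d, hd⟩)
  have h1 : y.1 d = x.1 d := by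
    rw [x.2 _ d hle w hw, y.2 _ d hle w (hy.trans hw)]
  change y.1 d ∈ u d
  rw [h1]
  exact (hu d hd).2

theorem liftFun_ofWord {Q : Type v} [Mul Q] [Finite Q] (θ : FreeSemigroup A →ₙ* Q)
    (w : FreeSemigroup A) : liftFun θ (ofWord w) = θ w := rfl

theorem liftFun_mul {Q : Type v} [Mul Q] [Finite Q] (θ : FreeSemigroup A →ₙ* Q)
    (x y : FreeProfiniteSemigroup A) : liftFun θ (x * y) = liftFun θ x * liftFun θ y := by
  obtain ⟨s, hs, hs'⟩ := exists_word_lift θ x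
  obtain ⟨t, ht, ht'⟩ := exists_word_lift θ y
  rw [hs', ht', ← map_mul]
  refine liftFun_eq _ _ ⟨_, finite_ker_quotient θ⟩ le_rfl _ ?_
  change x.1 _ * y.1 _ = _
  rw [hs, ht]
  rfl

theorem liftFun_comp {Q R : Type*} [Mul Q] [Finite Q] [Mul R] [Finite R]
    (θ : FreeSemigroup A →ₙ* Q) (f : Q →ₙ* R) (x : FreeProfiniteSemigroup A) :
    liftFun (f.comp θ) x = f (liftFun θ x) := by
  obtain ⟨w, hw, hw'⟩ := exists_word_lift θ x
  rw [hw', liftFun_eq (f.comp θ) x ⟨_, finite_ker_quotient θ⟩ (fun {s t} h => congrArg f h) w hw]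
  rfl

theorem exists_word_eq {Q : Type v} [Mul Q] [Finite Q] (θ : FreeSemigroup A →ₙ* Q)
    (x : FreeProfiniteSemigroup A) : ∃ w, θ w = liftFun θ x :=
  let ⟨w, _, hw⟩ := exists_word_lift θ x
  ⟨w, hw.symm⟩

/-! ### The ω-power of a substitution. -/

theorem iterate_map_ofWord (φ : FreeSemigroup A →ₙ* FreeSemigroup A) (k : ℕ)
    (w : FreeSemigroup A) : (map φ)^[k] (ofWord w) = ofWord (φ^[k] w) := by
  induction k generalizing w with
  | zero => rfl
  | succ k ih => rw [Function.iterate_succ_apply, Function.iterate_succ_apply, ← ih]; rfl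

theorem finite_mulHom [Finite A] (Q : Type v) [Mul Q] [Finite Q] :
    Finite (FreeSemigroup A →ₙ* Q) :=
  Finite.of_injective (fun θ x => θ (FreeSemigroup.of x))
    fun _ _ h => FreeSemigroup.hom_ext h

/-- On a finite quotient, `φ ^ ω` is a power of `φ`. -/
theorem exists_liftFun_omegaPower_eq {A Q : Type u} [Finite A] [Mul Q] [Finite Q]
    (φ : FreeSemigroup A →ₙ* FreeSemigroup A) (θ : FreeSemigroup A →ₙ* Q) :
    ∃ N > 0, ∀ k > 0, ∀ x, liftFun θ (omegaPower (map φ) x) = liftFun θ ((map φ)^[N * k] x) := by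
  have := finite_mulHom (A := A) Q
  refine exists_comp_omegaPower_eq (map φ) (tendsto_omegaPower φ)
    (Set.range fun θ : FreeSemigroup A →ₙ* Q => liftFun θ) (Set.finite_range _) ?_ (liftFun θ)
    ⟨θ, rfl⟩ (isLocallyConstant_liftFun θ)
  rintro _ ⟨θ, rfl⟩
  exact ⟨θ.comp φ, funext fun y => (liftFun_map φ θ y).symm⟩

theorem omegaPower_mul [Finite A] (φ : FreeSemigroup A →ₙ* FreeSemigroup A)
    (x y : FreeProfiniteSemigroup A) :
    omegaPower (map φ) (x * y) = omegaPower (map φ) x * omegaPower (map φ) y := by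
  refine ext_coord fun c => ?_
  have := c.2
  obtain ⟨N, -, h⟩ := exists_liftFun_omegaPower_eq φ c.1.mkMulHom
  rw [← liftFun_mkMulHom c, ← liftFun_mkMulHom c, liftFun_mul, h 1 one_pos, h 1 one_pos,
    h 1 one_pos, ← liftFun_mul, iterate_map_mul]

theorem omegaPower_omegaPower [Finite A] (φ : FreeSemigroup A →ₙ* FreeSemigroup A)
    (x : FreeProfiniteSemigroup A) :
    omegaPower (map φ) (omegaPower (map φ) x) = omegaPower (map φ) x := by
  refine ext_coord fun c => ?_
  have := c.2
  have hlift : ∀ (k : ℕ) (θ : FreeSemigroup A →ₙ* c.1.Quotient),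
      ∃ η : FreeSemigroup A →ₙ* c.1.Quotient, ∀ y, liftFun θ ((map φ)^[k] y) = liftFun η y := by
    intro k
    induction k with
    | zero => exact fun θ => ⟨θ, fun y => rfl⟩
    | succ k ih =>
      intro θ
      obtain ⟨η, hη⟩ := ih θ
      exact ⟨η.comp φ, fun y => by rw [Function.iterate_succ_apply, hη, liftFun_map]⟩
  obtain ⟨N, hN, h⟩ := exists_liftFun_omegaPower_eq φ c.1.mkMulHom
  obtain ⟨η, hη⟩ := hlift (N * 1) c.1.mkMulHom
  -- Modulo c the outer ω-power is the N-th iterate and the inner one the iterate of exponent MN;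
  -- the total N(1 + M) is again a multiple of N.
  obtain ⟨M, hM, h'⟩ := exists_liftFun_omegaPower_eq φ η
  rw [← liftFun_mkMulHom c, ← liftFun_mkMulHom c, h 1 one_pos, hη, h' N hN, ← hη,
    ← Function.iterate_add_apply, h (1 + M) (by omega)]
  congr 2
  ring

/-! #### Factorizations -/

end FreeProfiniteSemigroup

/-- The target of the homomorphism that records the values of a word and of its factorizations into
two words. -/
def SplitValues (Q : Type u) : Type u := Q × Set (Q × Q)

namespace SplitValues

variable {Q : Type u} [Mul Q]

instance [Finite Q] : Finite (SplitValues Q) := inferInstanceAs (Finite (Q × Set (Q × Q)))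

/-- A cut of a product falls in the left word, in the right word, or at the seam. -/
instance : Mul (SplitValues Q) where
  mul p q := (p.1 * q.1, {z | (∃ t ∈ p.2, (t.1, t.2 * q.1) = z) ∨
    (∃ t ∈ q.2, (p.1 * t.1, t.2) = z) ∨ z = (p.1, q.1)})

/-- The first projection. -/
def fstHom : SplitValues Q →ₙ* Q where
  toFun p := p.1
  map_mul' _ _ := rfl

end SplitValues

/-- Equidivisibility of the free semigroup; equal cuts form a separate case because there is no
empty word. -/
theorem FreeSemigroup.mul_eq_mul_iff {A : Type u} {u v s t : FreeSemigroup A} :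
    s * t = u * v ↔ (∃ z, s * z = u ∧ z * v = t) ∨ (∃ z, u * z = s ∧ z * t = v) ∨
      (s = u ∧ t = v) := by
  constructor
  · intro h
    have h' : s.letters ++ t.letters = u.letters ++ v.letters := congrArg letters h
    rcases List.append_eq_append_iff.1 h' with ⟨z, h1, h2⟩ | ⟨z, h1, h2⟩
    · rcases eq_or_ne z [] with rfl | hz
      · exact Or.inr (Or.inr ⟨letters_injective (by simpa using h1.symm),
          letters_injective (by simpa using h2)⟩)
      · obtain ⟨z, rfl⟩ := exists_letters_eq hz
        exact Or.inl ⟨z, letters_injective h1.symm, letters_injective h2.symm⟩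
    · rcases eq_or_ne z [] with rfl | hz
      · exact Or.inr (Or.inr ⟨letters_injective (by simpa using h1),
          letters_injective (by simpa using h2.symm)⟩)
      · obtain ⟨z, rfl⟩ := exists_letters_eq hz
        exact Or.inr (Or.inl ⟨z, letters_injective h1.symm, letters_injective h2.symm⟩)
  · rintro (⟨z, rfl, rfl⟩ | ⟨z, rfl, rfl⟩ | ⟨rfl, rfl⟩)
    · rw [mul_assoc]
    · rw [mul_assoc]
    · rfl

/-- The values of a word and of its factorizations into two words under `θ`. -/
def splitHom {A : Type u} {Q : Type v} [Mul Q] (θ : FreeSemigroup A →ₙ* Q) :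
    FreeSemigroup A →ₙ* SplitValues Q where
  toFun w := (θ w, {z | ∃ s t, s * t = w ∧ (θ s, θ t) = z})
  map_mul' u v := by
    refine Prod.ext (map_mul θ u v) (Set.ext fun z => ?_)
    change (∃ s t, s * t = u * v ∧ (θ s, θ t) = z) ↔
      (∃ p ∈ {z | ∃ s t, s * t = u ∧ (θ s, θ t) = z}, (p.1, p.2 * θ v) = z) ∨
      (∃ p ∈ {z | ∃ s t, s * t = v ∧ (θ s, θ t) = z}, (θ u * p.1, p.2) = z) ∨ z = (θ u, θ v)
    constructor
    · rintro ⟨s, t, h, rfl⟩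
      rcases FreeSemigroup.mul_eq_mul_iff.1 h with ⟨y, rfl, rfl⟩ | ⟨y, rfl, rfl⟩ | ⟨rfl, rfl⟩
      · exact Or.inl ⟨_, ⟨s, y, rfl, rfl⟩, by simp⟩
      · exact Or.inr (Or.inl ⟨_, ⟨y, t, rfl, rfl⟩, by simp⟩)
      · exact Or.inr (Or.inr rfl)
    · rintro (⟨_, ⟨s, t, rfl, rfl⟩, rfl⟩ | ⟨_, ⟨s, t, rfl, rfl⟩, rfl⟩ | rfl)
      · exact ⟨s, t * v, (mul_assoc _ _ _).symm, by simp⟩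
      · exact ⟨u * s, t, mul_assoc _ _ _, by simp⟩
      · exact ⟨u, v, rfl, rfl⟩

/-- The words truncated to length at most `n`. -/
def TruncatedWord (A : Type u) (n : ℕ) : Type u := {l : List A // l.length ≤ n}

instance (A : Type u) [Finite A] (n : ℕ) : Finite (TruncatedWord A n) :=
  (List.finite_length_le A n).to_subtype

instance (A : Type u) (n : ℕ) : Mul (TruncatedWord A n) where
  mul p q := ⟨(p.1 ++ q.1).take n, List.length_take_le _ _⟩

/-- Truncation of words. -/
def truncateHom (A : Type u) (n : ℕ) : FreeSemigroup A →ₙ* TruncatedWord A n where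
  toFun w := ⟨w.letters.take n, List.length_take_le _ _⟩
  map_mul' u v := by
    apply Subtype.ext
    change (u.letters ++ v.letters).take n = (u.letters.take n ++ v.letters.take n).take n
    simp only [List.take_append, List.take_take, List.length_take, min_self]
    congr 2
    omega

theorem eq_of_truncateHom_eq {A : Type u} {n : ℕ} {u w : FreeSemigroup A}
    (hn : w.letters.length < n) (h : truncateHom A n u = truncateHom A n w) : u = w := by
  have h' : u.letters.take n = w.letters.take n := congrArg Subtype.val h
  rw [List.take_of_length_le hn.le] at h'
  apply FreeSemigroup.letters_injective
  have hlen := congrArg List.length h'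
  rw [List.length_take] at hlen
  rwa [List.take_of_length_le (by omega)] at h'

namespace FreeProfiniteSemigroup

/-- Truncation just beyond the length of w would turn this into an equality uw = w of words. It
keeps words out of G(τ), whose elements satisfy eg = g. -/
theorem mul_ofWord_ne {A : Type u} [Finite A] (x : FreeProfiniteSemigroup A)
    (w : FreeSemigroup A) : x * ofWord w ≠ ofWord w := by
  intro h
  have h' := congrArg (liftFun (truncateHom A (w.letters.length + 1))) h
  obtain ⟨u, hu⟩ := exists_word_eq (truncateHom A (w.letters.length + 1)) x
  rw [liftFun_mul, ← hu, liftFun_ofWord, ← map_mul] at h'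
  have h2 := congrArg (fun w => w.letters.length) (eq_of_truncateHom_eq (Nat.lt_succ_self _) h')
  simp only [FreeSemigroup.letters_mul, List.length_append] at h2
  exact u.letters_ne_nil (List.length_eq_zero_iff.1 (by omega))

/-- Factorizations in the free profinite semigroup lift to factorizations of approximating words. -/
theorem exists_factorization {A : Type u} {Q : Type v} [Mul Q] [Finite Q]
    (θ : FreeSemigroup A →ₙ* Q) {x y : FreeProfiniteSemigroup A} {w : FreeSemigroup A}
    (h : splitHom θ w = liftFun (splitHom θ) (x * y)) :
    ∃ s t, s * t = w ∧ θ s = liftFun θ x ∧ θ t = liftFun θ y := by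
  obtain ⟨x₀, hx₀⟩ := exists_word_eq (splitHom θ) x
  obtain ⟨y₀, hy₀⟩ := exists_word_eq (splitHom θ) y
  have hx : θ x₀ = liftFun θ x :=
    (congrArg SplitValues.fstHom hx₀).trans (liftFun_comp (splitHom θ) SplitValues.fstHom x).symm
  have hy : θ y₀ = liftFun θ y :=
    (congrArg SplitValues.fstHom hy₀).trans (liftFun_comp (splitHom θ) SplitValues.fstHom y).symm
  rw [liftFun_mul, ← hx₀, ← hy₀, ← map_mul] at h
  have hmem : (θ x₀, θ y₀) ∈ (splitHom θ (x₀ * y₀)).2 := ⟨x₀, y₀, rfl, rfl⟩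
  rw [← h] at hmem
  obtain ⟨s, t, hst, e⟩ := hmem
  obtain ⟨e1, e2⟩ := Prod.ext_iff.1 e
  exact ⟨s, t, hst, e1.trans hx, e2.trans hy⟩

theorem exists_mem_eq_of_mem_closure {A : Type u} {L : Set (FreeSemigroup A)} {Q : Type v} [Mul Q]
    [Finite Q] (θ : FreeSemigroup A →ₙ* Q) {x : FreeProfiniteSemigroup A}
    (hx : x ∈ closure (ofWord '' L)) : ∃ w ∈ L, θ w = liftFun θ x := by
  obtain ⟨_, h, w, hw, rfl⟩ := mem_closure_iff.1 hx _ ((isLocallyConstant_liftFun θ).isOpen_fiber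
    (liftFun θ x)) rfl
  exact ⟨w, hw, h⟩

theorem mem_closure_of_forall {A : Type u} {s : Set (FreeProfiniteSemigroup A)}
    {x : FreeProfiniteSemigroup A} (h : ∀ c : FiniteCon A, ∃ y ∈ s, y.1 c = x.1 c) :
    x ∈ closure s := by
  rw [mem_closure_iff]
  intro U hU hx
  obtain ⟨c, hc⟩ := exists_con_of_isOpen hU hx
  obtain ⟨y, hy, hyx⟩ := h c
  exact ⟨y, hc y hyx, hy⟩

/-- The closure of a factorial language contains the left factors of its elements. -/
theorem left_mem_closure {A : Type u} {L : Set (FreeSemigroup A)}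
    (hL : ∀ s t, s * t ∈ L → s ∈ L) {x y : FreeProfiniteSemigroup A}
    (h : x * y ∈ closure (ofWord '' L)) : x ∈ closure (ofWord '' L) := by
  refine mem_closure_of_forall fun c => ?_
  have := c.2
  obtain ⟨w, hw, e⟩ := exists_mem_eq_of_mem_closure (splitHom c.1.mkMulHom) h
  obtain ⟨s, t, rfl, hs, -⟩ := exists_factorization _ e
  exact ⟨ofWord s, ⟨s, hL s t hw, rfl⟩, by rw [← liftFun_mkMulHom c x, ← hs]; rfl⟩

/-- The closure of a factorial language contains the right factors of its elements. -/
theorem right_mem_closure {A : Type u} {L : Set (FreeSemigroup A)}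
    (hL : ∀ s t, s * t ∈ L → t ∈ L) {x y : FreeProfiniteSemigroup A}
    (h : x * y ∈ closure (ofWord '' L)) : y ∈ closure (ofWord '' L) := by
  refine mem_closure_of_forall fun c => ?_
  have := c.2
  obtain ⟨w, hw, e⟩ := exists_mem_eq_of_mem_closure (splitHom c.1.mkMulHom) h
  obtain ⟨s, t, rfl, -, ht⟩ := exists_factorization _ e
  exact ⟨ofWord t, ⟨t, hL s t hw, rfl⟩, by rw [← liftFun_mkMulHom c y, ← ht]; rfl⟩

/-- If `u x v`, with words `u` and `v`, is in the closure of a language, then `x` is approximated by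
words `t` such that `u t v` is in the language. -/
theorem exists_word_between {A : Type u} [Finite A] {L : Set (FreeSemigroup A)} {Q : Type v}
    [Mul Q] [Finite Q] (θ : FreeSemigroup A →ₙ* Q) {u v : FreeSemigroup A}
    {x : FreeProfiniteSemigroup A} (h : ofWord u * (x * ofWord v) ∈ closure (ofWord '' L)) :
    ∃ t, u * (t * v) ∈ L ∧ θ t = liftFun θ x := by
  -- The two cuts are nested: first u is split off, then v. The truncation components force the
  -- outer factors to be exactly u and v, not mere approximations.
  let θv := θ.prod (truncateHom A (v.letters.length + 1))
  let θu := (splitHom θv).prod (truncateHom A (u.letters.length + 1))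
  obtain ⟨w, hw, e⟩ := exists_mem_eq_of_mem_closure (splitHom θu) h
  obtain ⟨s, r, rfl, hs, hr⟩ := exists_factorization _ e
  have hs' : s = u := eq_of_truncateHom_eq (Nat.lt_succ_self _) (congrArg Prod.snd hs)
  have hr' : splitHom θv r = liftFun (splitHom θv) (x * ofWord v) :=
    (congrArg Prod.fst hr).trans (liftFun_comp θu (MulHom.fst _ _) _).symm
  obtain ⟨t, z, rfl, ht, hz⟩ := exists_factorization _ hr'
  have hz' : z = v := eq_of_truncateHom_eq (Nat.lt_succ_self _) (congrArg Prod.snd hz)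
  subst hs' hz'
  exact ⟨t, hw, (congrArg Prod.fst ht).trans (liftFun_comp θv (MulHom.fst _ _) _).symm⟩

end FreeProfiniteSemigroup

/-! ### Maximal subgroups of compact semigroups -/

section Stability

variable {S : Type u} [Semigroup S] [TopologicalSpace S] [T2Space S] [CompactSpace S]
  [ContinuousMul S]

/-- Stability of compact semigroups. The pairs (e, f) with exf = x and f in rS form a compact
subsemigroup of S × Sᵐᵒᵖ; an idempotent pair in it satisfies xf = exff = x. -/
theorem exists_mul_mul_eq_self_right {x p r q : S} (h : p * x * (r * q) = x) :
    ∃ s, x * r * s = x := by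
  let K : Set (S × Sᵐᵒᵖ) := {z | z.1 * x * z.2.unop = x ∧ z.2.unop ∈ Set.range fun s => r * s}
  have hK : IsClosed K := by
    refine IsClosed.inter (isClosed_eq (by fun_prop) continuous_const) ?_
    exact (isCompact_range (by fun_prop)).isClosed.preimage
      (MulOpposite.continuous_unop.comp continuous_snd)
  obtain ⟨⟨e, f⟩, ⟨hef, s, hs⟩, hidem⟩ := exists_idempotent_in_compact_subsemigroup
    (M := S × Sᵐᵒᵖ) (fun z => by fun_prop) K ⟨(p, MulOpposite.op (r * q)), h, q, rfl⟩ hK.isCompact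
    (by
      rintro ⟨e, f⟩ ⟨he, s, hs⟩ ⟨e', f'⟩ ⟨he', s', hs'⟩
      dsimp only at he he' hs hs'
      refine ⟨?_, s' * f.unop, ?_⟩
      · change e * e' * x * (f'.unop * f.unop) = x
        rw [show e * e' * x * (f'.unop * f.unop) = e * (e' * x * f'.unop) * f.unop by
          simp only [mul_assoc], he', he]
      · change r * (s' * f.unop) = f'.unop * f.unop
        rw [← mul_assoc, hs'])
  have hf : f.unop * f.unop = f.unop := congrArg MulOpposite.unop (Prod.ext_iff.1 hidem).2
  dsimp only at hef hs
  refine ⟨s, ?_⟩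
  rw [mul_assoc, hs]
  conv_lhs => rw [← hef]
  rw [mul_assoc, hf, hef]

theorem exists_mul_mul_eq_self_left {x p r q : S} (h : q * r * x * p = x) :
    ∃ s, s * (r * x) = x := by
  obtain ⟨s, hs⟩ := exists_mul_mul_eq_self_right (x := MulOpposite.op x) (p := MulOpposite.op p)
    (r := MulOpposite.op r) (q := MulOpposite.op q) (by
      rw [← MulOpposite.op_mul, ← MulOpposite.op_mul, ← MulOpposite.op_mul, ← mul_assoc, h])
  refine ⟨s.unop, ?_⟩
  simpa using congrArg MulOpposite.unop hs

end Stability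

section SemigroupUnits

variable {S : Type u} [Semigroup S]

/-- The group of units of the monoid `e S e`. -/
def unitsAt (e : S) : Set S :=
  {x | e * x = x ∧ x * e = x ∧ ∃ y, e * y = y ∧ y * e = y ∧ x * y = e ∧ y * x = e}

variable {e : S}

theorem isSubgroupOfSemigroup_unitsAt (he : e * e = e) : IsSubgroupOfSemigroup (unitsAt e) := by
  refine ⟨?_, e, ⟨he, he, e, he, he, he, he⟩, ?_⟩
  · rintro x ⟨hx1, hx2, y, hy1, hy2, hxy, hyx⟩ x' ⟨hx1', hx2', y', hy1', hy2', hxy', hyx'⟩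
    refine ⟨by rw [← mul_assoc, hx1], by rw [mul_assoc, hx2'], y' * y, by rw [← mul_assoc, hy1'],
      by rw [mul_assoc, hy2], ?_, ?_⟩
    · rw [mul_assoc, ← mul_assoc x', hxy', hy1, hxy]
    · rw [mul_assoc, ← mul_assoc y, hyx, hx1', hyx']
  · rintro x ⟨hx1, hx2, y, hy1, hy2, hxy, hyx⟩
    exact ⟨hx1, hx2, y, ⟨hy1, hy2, x, hx1, hx2, hyx, hxy⟩, hxy, hyx⟩

/-- In a larger subgroup e is still idempotent, hence the neutral element, so all members are units
of eSe. -/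
theorem maximal_unitsAt (he : e * e = e) : Maximal IsSubgroupOfSemigroup (unitsAt e) := by
  refine ⟨isSubgroupOfSemigroup_unitsAt he, ?_⟩
  rintro H ⟨-, f, -, hf⟩ hle x hx
  have heH : e ∈ H := hle ⟨he, he, e, he, he, he, he⟩
  have hfe : f = e := by
    obtain ⟨h1, -, y, -, hey, -⟩ := hf e heH
    rw [← hey]
    conv_lhs => rw [← he, mul_assoc]
    rw [hey, (hf e heH).2.1]
  subst hfe
  obtain ⟨h1, h2, y, hy, hxy, hyx⟩ := hf x hx
  exact ⟨h1, h2, y, (hf y hy).1, (hf y hy).2.1, hxy, hyx⟩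

theorem WithOne.exists_coe_eq_mul_coe (p : WithOne S) (s : S) :
    ∃ z : S, (z : WithOne S) = p * s := by
  induction p with
  | one => exact ⟨s, (one_mul _).symm⟩
  | coe p => exact ⟨p * s, WithOne.coe_mul _ _⟩

theorem WithOne.exists_coe_eq_coe_mul (p : WithOne S) (s : S) :
    ∃ z : S, (z : WithOne S) = s * p := by
  induction p with
  | one => exact ⟨s, (mul_one _).symm⟩
  | coe p => exact ⟨s * p, WithOne.coe_mul _ _⟩

/-- An `𝓗`-class that meets its square consists of the units of a local monoid. -/
theorem greenR_and_greenL_iff {x s t : S} (hs : x * x * s = x) (ht : t * (x * x) = x) (y : S) :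
    GreenR y x ∧ GreenL y x ↔ y ∈ unitsAt (x * s) := by
  -- Both sides equal t·x²·s.
  have e1 : t * x = x * s := by
    conv_lhs => rw [← hs]
    conv_rhs => rw [← ht]
    simp only [mul_assoc]
  have ex : x * s * x = x := by rw [← e1, mul_assoc, ht]
  have xe : x * (x * s) = x := by rw [← mul_assoc, hs]
  constructor
  · rintro ⟨⟨⟨s₁, hs₁⟩, t₁, ht₁⟩, ⟨s₂, hs₂⟩, t₂, ht₂⟩
    have ey : x * s * y = y := by
      rw [← WithOne.coe_inj, WithOne.coe_mul, ← ht₁, ← mul_assoc, ← WithOne.coe_mul, ex]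
    have ye : y * (x * s) = y := by
      rw [← WithOne.coe_inj, WithOne.coe_mul, ← ht₂, mul_assoc, ← WithOne.coe_mul, xe]
    obtain ⟨z, hz⟩ := WithOne.exists_coe_eq_mul_coe s₁ s
    obtain ⟨z', hz'⟩ := WithOne.exists_coe_eq_coe_mul s₂ t
    have hyz : y * z = x * s := by
      rw [← WithOne.coe_inj, WithOne.coe_mul, hz, ← mul_assoc, hs₁, WithOne.coe_mul]
    have hzy : z' * y = x * s := by
      rw [← e1, ← WithOne.coe_inj, WithOne.coe_mul, hz', mul_assoc, hs₂, WithOne.coe_mul]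
    have ee : x * s * (x * s) = x * s := by rw [← mul_assoc, ex]
    -- With e = xs, the right inverse z and the left inverse z' agree after compression to eSe,
    -- giving a two-sided inverse.
    have hl : x * s * z * (x * s) = z' * (x * s) := by
      rw [← hzy, mul_assoc z', hyz, hzy, mul_assoc, ee]
    refine ⟨ey, ye, x * s * z * (x * s), ?_, ?_, ?_, ?_⟩
    · rw [← mul_assoc, ← mul_assoc (x * s), ee]
    · rw [mul_assoc (x * s * z), ee]
    · rw [← mul_assoc y, ← mul_assoc y, ye, hyz, ee]
    · rw [hl, mul_assoc, ey, hzy]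
  · rintro ⟨ey, ye, y', -, -, hy1, hy2⟩
    refine ⟨⟨⟨(y' * x : S), ?_⟩, (s * y : S), ?_⟩, ⟨(x * y' : S), ?_⟩, (y * t : S), ?_⟩
    · rw [← WithOne.coe_mul, ← mul_assoc, hy1, ex]
    · rw [← WithOne.coe_mul, ← mul_assoc, ey]
    · rw [← WithOne.coe_mul, mul_assoc, hy2, xe]
    · rw [← WithOne.coe_mul, mul_assoc, e1, ye]

/-- The group structure on the units of `e S e`. -/
noncomputable abbrev unitsAtGroup (he : e * e = e) : Group (unitsAt e) :=
  letI : Mul (unitsAt e) :=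
    ⟨fun x y => ⟨x.1 * y.1, (isSubgroupOfSemigroup_unitsAt he).1 _ x.2 _ y.2⟩⟩
  letI : One (unitsAt e) := ⟨⟨e, he, he, e, he, he, he, he⟩⟩
  letI : Inv (unitsAt e) := ⟨fun x => ⟨x.2.2.2.choose,
    x.2.2.2.choose_spec.1, x.2.2.2.choose_spec.2.1, x.1, x.2.1, x.2.2.1,
    x.2.2.2.choose_spec.2.2.2, x.2.2.2.choose_spec.2.2.1⟩⟩
  Group.ofLeftAxioms (fun _ _ _ => Subtype.ext (mul_assoc _ _ _)) (fun x => Subtype.ext x.2.1)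
    fun x => Subtype.ext x.2.2.2.choose_spec.2.2.2

theorem isClosed_unitsAt [TopologicalSpace S] [T2Space S] [CompactSpace S] [ContinuousMul S]
    (e : S) : IsClosed (unitsAt e) := by
  have h : unitsAt e = Prod.fst '' {z : S × S | e * z.1 = z.1 ∧ z.1 * e = z.1 ∧ e * z.2 = z.2 ∧
      z.2 * e = z.2 ∧ z.1 * z.2 = e ∧ z.2 * z.1 = e} := by
    ext x
    constructor
    · rintro ⟨h1, h2, y, h3⟩
      exact ⟨(x, y), ⟨h1, h2, h3⟩, rfl⟩
    · rintro ⟨⟨x, y⟩, ⟨h1, h2, h3⟩, rfl⟩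
      exact ⟨h1, h2, y, h3⟩
  rw [h]
  refine (IsClosed.isCompact ?_).image continuous_fst |>.isClosed
  refine IsClosed.inter ?_ (IsClosed.inter ?_ (IsClosed.inter ?_ (IsClosed.inter ?_
    (IsClosed.inter ?_ ?_)))) <;>
  exact isClosed_eq (by fun_prop) (by fun_prop)

end SemigroupUnits

/-- A compact Hausdorff group with continuous multiplication is a topological group. -/
theorem isTopologicalGroup_of_compact {G : Type u} [Group G] [TopologicalSpace G] [T2Space G]
    [CompactSpace G] [ContinuousMul G] : IsTopologicalGroup G where
  continuous_inv := by
    -- (x, y) ↦ (x, xy) is a continuous bijection of a compact Hausdorff space, so its inverse (x,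
    -- y) ↦ (x, x⁻¹y) is continuous.
    let f : G × G ≃ G × G := Equiv.prodShear (Equiv.refl G) Equiv.mulLeft
    have hf : Continuous f := by
      change Continuous fun p : G × G => (p.1, p.1 * p.2)
      fun_prop
    let g := hf.homeoOfEquivCompactToT2
    have h : (fun x : G => x⁻¹) = fun x => (g.symm (x, 1)).2 := by
      funext x
      change x⁻¹ = x⁻¹ * 1
      rw [mul_one]
    rw [h]
    fun_prop

/-- The universal property of the free profinite group, for maps into a maximal subgroup of a
profinite semigroup. -/
theorem FreeProfiniteGroup.exists_continuous_mulHom {X S : Type u} [Semigroup S]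
    [TopologicalSpace S] [T2Space S] [CompactSpace S] [TotallyDisconnectedSpace S]
    [ContinuousMul S] {e : S} (he : e * e = e) (f : X → S) (hf : ∀ x, f x ∈ unitsAt e) :
    ∃ Θ : FreeProfiniteGroup X →ₙ* S, Continuous Θ ∧ (∀ u, Θ u ∈ unitsAt e) ∧
      ∀ x, Θ (of x) = f x := by
  let _ : Group (unitsAt e) := unitsAtGroup he
  have : CompactSpace (unitsAt e) := isCompact_iff_compactSpace.1 (isClosed_unitsAt e).isCompact
  have : ContinuousMul (unitsAt e) := ⟨continuous_induced_rng.2 (by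
    change Continuous fun p : unitsAt e × unitsAt e => p.1.1 * p.2.1
    fun_prop)⟩
  have : IsTopologicalGroup (unitsAt e) := isTopologicalGroup_of_compact
  let P : ProfiniteGrp.{u} := ProfiniteGrp.of (unitsAt e)
  let φ : FreeGroup X →* unitsAt e := FreeGroup.lift fun x => ⟨f x, hf x⟩
  let F : GrpCat.of (FreeGroup X) ⟶ GrpCat.of P := GrpCat.ofHom φ
  let L := (ProfiniteGrp.ProfiniteCompletion.lift F).hom
  refine ⟨⟨fun u => (L u : unitsAt e).1, fun u v => ?_⟩, ?_, fun u => (L u : unitsAt e).2, ?_⟩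
  · rw [map_mul]
    rfl
  · exact continuous_subtype_val.comp L.continuous_toFun
  · intro x
    have h := ConcreteCategory.congr_hom (ProfiniteGrp.ProfiniteCompletion.lift_eta F)
      (FreeGroup.of x)
    have h2 : L (of x) = φ (FreeGroup.of x) := h
    change (L (of x) : unitsAt e).1 = f x
    rw [h2, FreeGroup.lift_apply_of]

/-! ### The maximal subgroup `G(τ)` -/

namespace ThueMorse

open FreeProfiniteSemigroup

theorem mul_mem_blocks_left {s t : FreeSemigroup AB} (h : s * t ∈ thueMorse.blocks) :
    s ∈ thueMorse.blocks := by
  rw [mem_blocks_iff] at h ⊢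
  exact h.mono (List.prefix_append _ _).isInfix

theorem mul_mem_blocks_right {s t : FreeSemigroup AB} (h : s * t ∈ thueMorse.blocks) :
    t ∈ thueMorse.blocks := by
  rw [mem_blocks_iff] at h ⊢
  exact h.mono (List.suffix_append s.letters _).isInfix

/-- The element `τ ^ ω (a)`. -/
noncomputable abbrev alpha : FreeProfiniteSemigroup AB := thueMorse.omega (FreeSemigroup.of .a)

theorem omega_mul (u v : FreeSemigroup AB) :
    thueMorse.omega (u * v) = thueMorse.omega u * thueMorse.omega v := by
  rw [Substitution.omega, map_mul]
  exact omegaPower_mul thueMorse _ _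

theorem omegaPower_alpha : omegaPower thueMorse.hat alpha = alpha :=
  omegaPower_omegaPower thueMorse _

/-- n! is even for large n, so only even powers of τ matter; these keep a as both first and last
letter. -/
theorem alpha_mem_of_isClosed {C : Set (FreeProfiniteSemigroup AB)} (hC : IsClosed C) (K : ℕ)
    (h : ∀ k ≥ K, ofWord (thueMorse^[2 * k] (FreeSemigroup.of .a)) ∈ C) : alpha ∈ C := by
  refine hC.mem_of_tendsto (tendsto_omegaPower thueMorse (ofWord (FreeSemigroup.of .a))) ?_
  filter_upwards [eventually_ge_atTop (2 * K + 2)] with n hn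
  obtain ⟨k, hk⟩ := Nat.dvd_factorial (n := n) two_pos (by omega)
  have := Nat.self_le_factorial n
  rw [iterate_map_ofWord, hk]
  exact h k (by omega)

theorem exists_mul_eq_of_prefix {A : Type u} {u w : FreeSemigroup A} (h : u.letters <+: w.letters)
    (hne : u.letters.length ≠ w.letters.length) : ∃ t, u * t = w := by
  obtain ⟨t, ht⟩ := h
  obtain ⟨t, rfl⟩ := FreeSemigroup.exists_letters_eq (l := t) (by
    rintro rfl
    simp [← ht] at hne)
  exact ⟨t, FreeSemigroup.letters_injective ht⟩

theorem exists_mul_eq_of_suffix {A : Type u} {u w : FreeSemigroup A} (h : u.letters <:+ w.letters)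
    (hne : u.letters.length ≠ w.letters.length) : ∃ t, t * u = w := by
  obtain ⟨t, ht⟩ := h
  obtain ⟨t, rfl⟩ := FreeSemigroup.exists_letters_eq (l := t) (by
    rintro rfl
    simp [← ht] at hne)
  exact ⟨t, FreeSemigroup.letters_injective ht⟩

theorem length_iterate_thueMorse (k : ℕ) :
    (thueMorse^[k] (FreeSemigroup.of .a)).letters.length = 2 ^ k := by
  rw [letters_iterate_thueMorse, length_iterate_sub, FreeSemigroup.letters_of]
  simp

theorem exists_prefix_alpha (m : ℕ) :
    ∃ s, ofWord (thueMorse^[2 * m] (FreeSemigroup.of .a)) * s = alpha := by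
  refine alpha_mem_of_isClosed (C := Set.range fun s =>
    ofWord (thueMorse^[2 * m] (FreeSemigroup.of .a)) * s)
    (isCompact_range (by fun_prop)).isClosed (m + 1) fun k hk => ?_
  obtain ⟨t, ht⟩ := exists_mul_eq_of_prefix (u := thueMorse^[2 * m] (FreeSemigroup.of .a))
    (w := thueMorse^[2 * k] (FreeSemigroup.of .a)) (by
      rw [letters_iterate_thueMorse, letters_iterate_thueMorse]
      exact iterate_sub_prefix (by omega)) (by
      rw [length_iterate_thueMorse, length_iterate_thueMorse]
      exact (Nat.pow_lt_pow_right (by norm_num) (by omega)).ne)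
  exact ⟨ofWord t, by rw [← ht, map_mul]⟩

theorem exists_suffix_alpha (m : ℕ) :
    ∃ s, s * ofWord (thueMorse^[2 * m] (FreeSemigroup.of .a)) = alpha := by
  refine alpha_mem_of_isClosed (C := Set.range fun s =>
    s * ofWord (thueMorse^[2 * m] (FreeSemigroup.of .a)))
    (isCompact_range (by fun_prop)).isClosed (m + 1) fun k hk => ?_
  obtain ⟨t, ht⟩ := exists_mul_eq_of_suffix (u := thueMorse^[2 * m] (FreeSemigroup.of .a))
    (w := thueMorse^[2 * k] (FreeSemigroup.of .a)) (by
      rw [letters_iterate_thueMorse, letters_iterate_thueMorse]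
      exact iterate_sub_suffix (by omega)) (by
      rw [length_iterate_thueMorse, length_iterate_thueMorse]
      exact (Nat.pow_lt_pow_right (by norm_num) (by omega)).ne)
  exact ⟨ofWord t, by rw [← ht, map_mul]⟩

theorem isConnection : thueMorse.IsConnection .a .a := by
  refine ⟨(mem_blocks_iff _).2 isFactor_aa, ?_, ?_⟩
  · obtain ⟨s, hs⟩ := exists_prefix_alpha 0
    exact ⟨s, by rw [← WithOne.coe_mul]; exact congrArg _ hs⟩
  · obtain ⟨s, hs⟩ := exists_suffix_alpha 0
    exact ⟨s, by rw [← WithOne.coe_mul]; exact congrArg _ hs⟩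

theorem alpha_mem_closure : alpha ∈ closure (ofWord '' thueMorse.blocks) := by
  refine alpha_mem_of_isClosed isClosed_closure 0 fun k _ => subset_closure ⟨_, ?_, rfl⟩
  rw [mem_blocks_iff, letters_iterate_thueMorse]
  exact ⟨2 * k, List.infix_rfl⟩

/-- Every block `y` yields a factor `τ ^ ω (y)` of `τ ^ ω (a)`. -/
theorem exists_mul_omega_mul {y : FreeSemigroup AB} (hy : IsFactor y.letters) :
    ∃ p q, p * thueMorse.omega y * q = alpha := by
  obtain ⟨K, hK⟩ := hy.eventually
  obtain ⟨p, s, hps⟩ := hK (2 * K + 1) (by omega)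
  -- τ³(a) = abb·a·baab. The outer blocks make both cofactors of y nonempty, and the odd exponent 2K
  -- + 1 leads to an even total.
  have e : sub^[2 * (K + 2)] [AB.a] = sub^[2 * K + 1] [.a, .b, .b] ++
      sub^[2 * K + 1] [.a] ++ sub^[2 * K + 1] [.b, .a, .a, .b] := by
    rw [← iterate_sub_append, ← iterate_sub_append, show 2 * (K + 2) = 2 * K + 1 + 3 by ring,
      Function.iterate_add_apply]
    rfl
  have hne : ∀ {l : List AB} (n : ℕ), l ≠ [] → sub^[n] l ≠ [] := by
    intro l n hl h
    have := congrArg List.length h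
    rw [length_iterate_sub] at this
    have h2 := Nat.pos_of_ne_zero fun h => hl (List.length_eq_zero_iff.1 h)
    have := Nat.mul_pos (Nat.two_pow_pos n) h2
    simp_all
  obtain ⟨p', hp'⟩ := FreeSemigroup.exists_letters_eq (l := sub^[2 * K + 1] [.a, .b, .b] ++ p)
    (by simp [hne])
  obtain ⟨s', hs'⟩ := FreeSemigroup.exists_letters_eq
    (l := s ++ sub^[2 * K + 1] [.b, .a, .a, .b]) (by simp [hne])
  have e' : thueMorse^[2 * (K + 2)] (FreeSemigroup.of .a) = p' * y * s' :=
    FreeSemigroup.letters_injective (by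
      rw [letters_iterate_thueMorse, FreeSemigroup.letters_mul, FreeSemigroup.letters_mul, hp', hs',
        FreeSemigroup.letters_of, e, ← hps]
      simp)
  obtain ⟨r, hr⟩ := exists_prefix_alpha (K + 2)
  -- Here α = p' y s' r, and τ^ω fixes α.
  refine ⟨thueMorse.omega p', thueMorse.omega s' * omegaPower thueMorse.hat r, ?_⟩
  rw [← omegaPower_alpha, ← hr, omegaPower_mul, e', ← mul_assoc, ← omega_mul, ← omega_mul]
  rfl

/-- As aa is a block, α² is a factor of α; stability strengthens this to α ∈ α²S and α ∈ Sα², the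
condition for the 𝓗-class of α to be a group. -/
theorem exists_alpha_mul_alpha_mul :
    ∃ s t, alpha * alpha * s = alpha ∧ t * (alpha * alpha) = alpha := by
  obtain ⟨p, q, h⟩ := exists_mul_omega_mul (y := FreeSemigroup.of AB.a * FreeSemigroup.of AB.a)
    isFactor_aa
  rw [omega_mul] at h
  obtain ⟨s, hs⟩ := exists_mul_mul_eq_self_right (x := alpha) (p := p) (r := alpha) (q := q)
    (by simpa only [mul_assoc] using h)
  obtain ⟨t, ht⟩ := exists_mul_mul_eq_self_left (x := alpha) (p := q) (r := alpha) (q := p)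
    (by simpa only [mul_assoc] using h)
  exact ⟨s, t, hs, ht⟩

/-- `G(τ)` is the group of units of a local monoid. -/
theorem exists_idempotent_G_eq : ∃ e : FreeProfiniteSemigroup AB, e * e = e ∧
    thueMorse.G .a .a = unitsAt e := by
  obtain ⟨s, t, hs, ht⟩ := exists_alpha_mul_alpha_mul
  refine ⟨alpha * s, ?_, Set.ext fun y => greenR_and_greenL_iff hs ht y⟩
  have e1 : t * alpha = alpha * s := by
    conv_lhs => rw [← hs]
    conv_rhs => rw [← ht]
    simp only [mul_assoc]
  rw [← mul_assoc, ← e1, mul_assoc t, ht, e1]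

/-- If y = ar = la, then τ^ω(y) lies in αS and in Sα. It is also a factor of α, so stability gives
both Green relations. Length one is separate because r and l would be empty. -/
theorem omega_mem_G {y : FreeSemigroup AB} (hy : IsFactor y.letters)
    (ha : StartsEndsWithA y.letters) : thueMorse.omega y ∈ thueMorse.G .a .a := by
  obtain ⟨p, q, h⟩ := exists_mul_omega_mul hy
  by_cases hlen : y.letters.length = 1
  · have hya : y = FreeSemigroup.of .a :=
      FreeSemigroup.letters_injective (ha.prefix_a.eq_of_length (by simp [hlen])).symm
    rw [hya]
    exact ⟨⟨⟨1, mul_one _⟩, 1, mul_one _⟩, ⟨1, one_mul _⟩, 1, one_mul _⟩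
  · obtain ⟨r, hr⟩ := exists_mul_eq_of_prefix (u := FreeSemigroup.of AB.a) ha.prefix_a
      (Ne.symm hlen)
    obtain ⟨l, hl⟩ := exists_mul_eq_of_suffix (u := FreeSemigroup.of AB.a) ha.suffix_a
      (Ne.symm hlen)
    have hr' : thueMorse.omega y = alpha * thueMorse.omega r := by rw [← omega_mul, hr]
    have hl' : thueMorse.omega y = thueMorse.omega l * alpha := by rw [← omega_mul, hl]
    constructor
    · obtain ⟨s, hs⟩ := exists_mul_mul_eq_self_right (x := alpha) (p := p)
        (r := thueMorse.omega r) (q := q) (by rw [hr'] at h; simpa only [mul_assoc] using h)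
      refine ⟨⟨s, ?_⟩, thueMorse.omega r, ?_⟩
      · rw [← WithOne.coe_mul, hr', hs]
      · rw [← WithOne.coe_mul, hr']
    · obtain ⟨s, hs⟩ := exists_mul_mul_eq_self_left (x := alpha) (p := q)
        (r := thueMorse.omega l) (q := p) (by rw [hl'] at h; simpa only [mul_assoc] using h)
      refine ⟨⟨s, ?_⟩, thueMorse.omega l, ?_⟩
      · rw [← WithOne.coe_mul, hl', hs]
      · rw [← WithOne.coe_mul, hl']

theorem alpha_mem_G : alpha ∈ thueMorse.G .a .a :=
  omega_mem_G (isFactor_singleton _) ⟨List.prefix_rfl, List.suffix_rfl⟩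

theorem omega_mem_G_of_returnSet (x : X) : thueMorse.omega x ∈ thueMorse.G .a .a := by
  obtain ⟨h1, h2⟩ := (mem_returnSet_iff x.1).1 x.2
  exact omega_mem_G (h2.mono ⟨[.a], [.a], by simp⟩) h1.1

theorem maximal_G : Maximal IsSubgroupOfSemigroup (thueMorse.G .a .a) := by
  obtain ⟨e, he, hG⟩ := exists_idempotent_G_eq
  rw [hG]
  exact maximal_unitsAt he

/-- If g' is the inverse of g, then α = g(g'α), so g is a left factor of α, and the closure of the
blocks is factorial. -/
theorem G_subset_closure : thueMorse.G .a .a ⊆ closure (ofWord '' thueMorse.blocks) := by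
  obtain ⟨e, he, hG⟩ := exists_idempotent_G_eq
  rw [hG]
  rintro g ⟨-, -, g', -, -, h, -⟩
  have ha : alpha ∈ unitsAt e := hG ▸ alpha_mem_G
  refine left_mem_closure (fun _ _ => mul_mem_blocks_left) (y := g' * alpha) ?_
  rw [← mul_assoc, h, ha.1]
  exact alpha_mem_closure

theorem G_subset_J : thueMorse.G .a .a ⊆ thueMorse.J := by
  refine fun g hg => ⟨G_subset_closure hg, ?_⟩
  obtain ⟨e, he, hG⟩ := exists_idempotent_G_eq
  rw [hG] at hg
  rintro ⟨w, -, rfl⟩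
  exact mul_ofWord_ne e w hg.1

/-- The elements `τ ^ ω (v)`, with `v` a product of elements of `a⁻¹ R(aa) a`, are dense in
`G(τ)`. -/
theorem G_subset_closure_range : thueMorse.G .a .a ⊆
    closure (Set.range fun v : FreeSemigroup X => thueMorse.omega (wordInclusion X v)) := by
  obtain ⟨e, he, hG⟩ := exists_idempotent_G_eq
  have hsub := isSubgroupOfSemigroup_unitsAt he
  have ha : alpha ∈ unitsAt e := hG ▸ alpha_mem_G
  intro g hg
  rw [hG] at hg
  -- The form αrα lets words be peeled off both ends of g.
  obtain ⟨r, hr, hg'⟩ : ∃ r ∈ unitsAt e, alpha * r * alpha = g := by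
    obtain ⟨h1, h2, a', h3, h4, h5, h6⟩ := ha
    have ha' : a' ∈ unitsAt e := ⟨h3, h4, alpha, h1, h2, h6, h5⟩
    refine ⟨a' * g * a', hsub.1 _ (hsub.1 _ ha' _ hg) _ ha', ?_⟩
    rw [← mul_assoc, ← mul_assoc, h5, hg.1, mul_assoc, h6, hg.2.1]
  refine mem_closure_of_forall fun c => ?_
  have := c.2
  obtain ⟨N, hN, hΩ⟩ := exists_liftFun_omegaPower_eq thueMorse c.1.mkMulHom
  set u : FreeSemigroup AB := thueMorse^[2 * N] (FreeSemigroup.of .a) with hu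
  obtain ⟨z, hz⟩ := exists_prefix_alpha N
  obtain ⟨z', hz'⟩ := exists_suffix_alpha N
  rw [← hu] at hz hz'
  -- With α = uz = z'u, this is a factor of αgα. The flanks are doubled since synchronization needs
  -- τ^{2N}(aa), not just τ^{2N}(a).
  have hmem : ofWord (u * u) * (z * r * z' * ofWord (u * u)) ∈
      closure (ofWord '' thueMorse.blocks) := by
    have h1 : alpha * (alpha * r * alpha) * alpha ∈ closure (ofWord '' thueMorse.blocks) :=
      G_subset_closure (hG ▸ hsub.1 _ (hsub.1 _ ha _ (hsub.1 _ (hsub.1 _ ha _ hr) _ ha)) _ ha)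
    refine left_mem_closure (fun _ _ => mul_mem_blocks_left) (y := z)
      (right_mem_closure (fun _ _ => mul_mem_blocks_right) (x := z') ?_)
    have e1 : z' * (ofWord (u * u) * (z * r * z' * ofWord (u * u)) * z) =
        z' * ofWord u * ((ofWord u * z) * r * (z' * ofWord u)) * (ofWord u * z) := by
      simp only [map_mul, mul_assoc]
    rw [e1, hz, hz']
    exact h1
  obtain ⟨t, ht, ht'⟩ := exists_word_between c.1.mkMulHom hmem
  have huu : (u * u).letters = sub^[2 * N] [.a, .a] := by
    rw [FreeSemigroup.letters_mul, hu, letters_iterate_thueMorse, ← iterate_sub_append]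
    rfl
  rw [mem_blocks_iff, FreeSemigroup.letters_mul _ (t * _), FreeSemigroup.letters_mul t, huu,
    ← List.append_assoc] at ht
  obtain ⟨t₁, ht₁, hf⟩ := ht.desubstitute
  obtain ⟨t₂, rfl⟩ := FreeSemigroup.exists_letters_eq (l := t₁) (by
    rintro rfl
    exact t.letters_ne_nil (by rw [ht₁, iterate_sub_nil]))
  have ht₂ : t = thueMorse^[2 * N] t₂ :=
    FreeSemigroup.letters_injective (by rw [ht₁, letters_iterate_thueMorse])
  have hy : (FreeSemigroup.of AB.a * t₂ * FreeSemigroup.of AB.a).letters =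
      [.a] ++ t₂.letters ++ [.a] := rfl
  obtain ⟨v, hv⟩ := exists_decomposition (FreeSemigroup.of AB.a * t₂ * FreeSemigroup.of AB.a)
    (by
      rw [hy]
      exact ⟨⟨t₂.letters ++ [.a], by simp⟩, ⟨[.a] ++ t₂.letters, rfl⟩⟩)
    (by simpa [hy] using hf)
  refine ⟨_, ⟨v, rfl⟩, ?_⟩
  have e2 : thueMorse^[2 * N] (FreeSemigroup.of AB.a * t₂ * FreeSemigroup.of AB.a) = u * t * u :=
    FreeSemigroup.letters_injective (by
      rw [letters_iterate_thueMorse, hy, iterate_sub_append, iterate_sub_append, ht₂, hu,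
        FreeSemigroup.letters_mul, FreeSemigroup.letters_mul, letters_iterate_thueMorse,
        letters_iterate_thueMorse]
      rfl)
  dsimp only
  -- Modulo c, τ^ω(a t₂ a) has the value of τ^{2N}(a t₂ a) = utu, and t that of z r z'; hence the
  -- value is that of uz·r·z'u = αrα = g.
  rw [← liftFun_mkMulHom c, ← liftFun_mkMulHom c, hv, Substitution.omega, hΩ 2 two_pos,
    iterate_map_ofWord, mul_comm N 2, e2, liftFun_ofWord, map_mul, map_mul, ht', ← hg',
    ← liftFun_ofWord c.1.mkMulHom u, ← liftFun_mul, ← liftFun_mul]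
  congr 1
  nth_rewrite 1 [← hz]
  rw [← hz']
  simp only [mul_assoc]

end ThueMorse

/-! ### Positive words in the free profinite group -/

namespace FreeProfiniteGroup

variable {X : Type u}

theorem ofFree_mul (f g : FreeGroup X) : ofFree (f * g) = ofFree f * ofFree g := rfl

theorem ofFree_one : ofFree (1 : FreeGroup X) = 1 := rfl

theorem ofFree_inv (f : FreeGroup X) : ofFree f⁻¹ = (ofFree f)⁻¹ := rfl

/-- A semigroup word over `X` as an element of the free profinite group. -/
def ofPositive : FreeSemigroup X →ₙ* FreeProfiniteGroup X where
  toFun v := ofFree (groupWord v)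
  map_mul' u v := by rw [map_mul, ofFree_mul]

theorem ofPositive_of (x : X) : ofPositive (FreeSemigroup.of x) = of x := rfl

/-- Positive words are dense because in a finite group inverses are positive powers. -/
theorem exists_ofPositive_mem [Nonempty X] {W : Set (FreeProfiniteGroup X)} (hW : IsOpen W)
    {u : FreeProfiniteGroup X} (hu : u ∈ W) : ∃ v : FreeSemigroup X, ofPositive v ∈ W := by
  obtain ⟨U, hU⟩ := ProfiniteGrp.exist_openNormalSubgroup_sub_open_nhds_of_one
    (U := (fun z => u * z) ⁻¹' W) (hW.preimage (by fun_prop)) (by simpa using hu)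
  let π : FreeProfiniteGroup X →* FreeProfiniteGroup X ⧸ U.toSubgroup := QuotientGroup.mk' _
  have : Finite (FreeProfiniteGroup X ⧸ U.toSubgroup) := inferInstance
  have hpow : ∀ h, (∃ v, π (ofPositive v) = h) → ∀ n, ∃ v, π (ofPositive v) = h ^ (n + 1) := by
    rintro h ⟨v, hv⟩ n
    induction n with
    | zero => exact ⟨v, by simpa using hv⟩
    | succ n ih =>
      obtain ⟨v', hv'⟩ := ih
      exact ⟨v' * v, by rw [map_mul, map_mul, hv', hv, ← pow_succ]⟩
  have hinv : ∀ h, (∃ v, π (ofPositive v) = h) → ∃ v, π (ofPositive v) = h⁻¹ := by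
    intro h hh
    have hc : 0 < Nat.card (FreeProfiniteGroup X ⧸ U.toSubgroup) := Nat.card_pos
    -- For a quotient of order c this is the power 2c - 1, which, unlike c - 1, is positive even
    -- when c = 1.
    obtain ⟨v, hv⟩ := hpow h hh (2 * Nat.card (FreeProfiniteGroup X ⧸ U.toSubgroup) - 2)
    refine ⟨v, hv.trans (eq_inv_of_mul_eq_one_left ?_)⟩
    rw [← pow_succ, show 2 * Nat.card (FreeProfiniteGroup X ⧸ U.toSubgroup) - 2 + 1 + 1 =
      Nat.card (FreeProfiniteGroup X ⧸ U.toSubgroup) * 2 by omega, pow_mul,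
      pow_card_eq_one', one_pow]
  have hall : ∀ f : FreeGroup X, ∃ v, π (ofPositive v) = π (ofFree f) := by
    intro f
    induction f using FreeGroup.induction_on with
    | C1 =>
      obtain ⟨x⟩ := ‹Nonempty X›
      obtain ⟨v, hv⟩ := hinv _ ⟨FreeSemigroup.of x, rfl⟩
      exact ⟨v * FreeSemigroup.of x, by
        rw [map_mul, map_mul, hv, inv_mul_cancel, ofFree_one, map_one]⟩
    | of x => exact ⟨FreeSemigroup.of x, rfl⟩
    | inv_of x h =>
      obtain ⟨v, hv⟩ := hinv _ h
      exact ⟨v, by rw [hv, ofFree_inv, map_inv]⟩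
    | mul f g hf hg =>
      obtain ⟨v, hv⟩ := hf
      obtain ⟨v', hv'⟩ := hg
      exact ⟨v * v', by rw [map_mul, map_mul, hv, hv', ofFree_mul, map_mul]⟩
  obtain ⟨f, hf⟩ := (ProfiniteGrp.ProfiniteCompletion.denseRange
    (GrpCat.of (FreeGroup X))).exists_mem_open (s := (fun z => u⁻¹ * z) ⁻¹' (U : Set _))
    (U.isOpen'.preimage (by fun_prop)) ⟨u, by simp⟩
  obtain ⟨v, hv⟩ := hall f
  refine ⟨v, ?_⟩
  have h1 : π (ofFree f) = π u := (QuotientGroup.eq.2 hf).symm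
  have h2 : u⁻¹ * ofPositive v ∈ U.toSubgroup := QuotientGroup.eq.1 (hv.trans h1).symm
  simpa using hU h2

theorem endOfWords_ofPositive (w : X → FreeSemigroup X) (v : FreeSemigroup X) :
    endOfWords w (ofPositive v) = ofPositive (FreeSemigroup.lift w v) := by
  induction v using FreeSemigroup.recOnMul with
  | ih1 x => exact endOfWords_of w x
  | ih2 x v h1 h2 => simp only [map_mul, h1, h2]

theorem iterate_endOfWords_ofPositive (w : X → FreeSemigroup X) (n : ℕ) (v : FreeSemigroup X) :
    (endOfWords w)^[n] (ofPositive v) = ofPositive ((FreeSemigroup.lift w)^[n] v) := by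
  induction n generalizing v with
  | zero => rfl
  | succ n ih => rw [Function.iterate_succ_apply, Function.iterate_succ_apply,
      endOfWords_ofPositive, ih]

end FreeProfiniteGroup

/-- A point outside a closed normal subgroup of a profinite group is separated from it by an open
normal subgroup. -/
theorem exists_open_normal_not_mem {G : Type u} [Group G] [TopologicalSpace G]
    [IsTopologicalGroup G] [CompactSpace G] [TotallyDisconnectedSpace G] (N : Subgroup G)
    [N.Normal] (hN : IsClosed (N : Set G)) {u : G} (hu : u ∉ N) :
    ∃ M : Subgroup G, M.Normal ∧ IsOpen (M : Set G) ∧ N ≤ M ∧ u ∉ M := by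
  obtain ⟨U, hU⟩ := ProfiniteGrp.exist_openNormalSubgroup_sub_open_nhds_of_one
    (U := (fun z => u * z⁻¹) ⁻¹' (N : Set G)ᶜ) (hN.isOpen_compl.preimage (by fun_prop))
    (by simpa using hu)
  refine ⟨N ⊔ U.toSubgroup, inferInstance,
    Subgroup.isOpen_mono le_sup_right U.isOpen', le_sup_left, fun h => ?_⟩
  obtain ⟨y, hy, z, hz, rfl⟩ := Subgroup.mem_sup_of_normal_right.1 h
  exact hU hz (by simpa using hy)

/-! ### A finite semigroup that evaluates products of code words -/

/-- Sets of triples (remainder before, value, remainder after), multiplied as relations. -/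
@[ext]
structure TrackValues (A : Type u) (H : Type v) (M : ℕ) : Type (max u v) where
  /-- The underlying set of triples. -/
  triples : Set ({l : List A // l.length ≤ M} × H × {l : List A // l.length ≤ M})

namespace TrackValues

instance (A : Type u) (H : Type v) (M : ℕ) [Finite A] [Finite H] : Finite (TrackValues A H M) :=
  have : Finite {l : List A // l.length ≤ M} := (List.finite_length_le A M).to_subtype
  Finite.of_injective TrackValues.triples fun _ _ => TrackValues.ext

instance (A : Type u) (H : Type v) (M : ℕ) [Mul H] : Mul (TrackValues A H M) where
  mul P Q := ⟨{z | ∃ m h h', (z.1, h, m) ∈ P.triples ∧ (m, h', z.2.2) ∈ Q.triples ∧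
    h * h' = z.2.1}⟩

variable {A : Type u} {H : Type v} {M : ℕ} {Y : Set (FreeSemigroup A)}

/-- The cut after `p` falls inside some word of Y or inside `t`, so the remainder has at most M
letters. This makes `trackHom` multiplicative with finitely many remainders. -/
theorem exists_split (hY : ∀ y ∈ Y, y.letters.length ≤ M) (L : List Y) {p q t : List A}
    (ht : t.length ≤ M) (h : p ++ q = (L.map fun y => y.1.letters).flatten ++ t) :
    ∃ (L₁ L₂ : List Y) (m : List A), L = L₁ ++ L₂ ∧ m.length ≤ M ∧
      p = (L₁.map fun y => y.1.letters).flatten ++ m ∧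
      m ++ q = (L₂.map fun y => y.1.letters).flatten ++ t := by
  induction L generalizing p with
  | nil =>
    refine ⟨[], [], p, rfl, ?_, rfl, h⟩
    have := congrArg List.length h
    simp at this
    omega
  | cons y L ih =>
    by_cases hp : y.1.letters.length ≤ p.length
    · rw [List.map_cons, List.flatten_cons, List.append_assoc] at h
      obtain ⟨p', rfl⟩ := List.prefix_of_prefix_length_le (List.prefix_append _ _)
        (h ▸ List.prefix_append p q) hp
      rw [List.append_assoc, List.append_cancel_left_eq] at h
      obtain ⟨L₁, L₂, m, rfl, hm, rfl, hq⟩ := ih h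
      exact ⟨y :: L₁, L₂, m, rfl, hm, by simp, hq⟩
    · exact ⟨[], y :: L, p, rfl, (not_le.1 hp).le.trans (hY _ y.2), rfl, h⟩

/-- The homomorphism that records the values under `η` of the products of elements of `Y` inside a
word. -/
def trackHom [Monoid H] (hY : ∀ y ∈ Y, y.letters.length ≤ M) (η : Y → H) :
    FreeSemigroup A →ₙ* TrackValues A H M where
  toFun w := ⟨{z | ∃ L : List Y,
    z.1.1 ++ w.letters = (L.map fun y => y.1.letters).flatten ++ z.2.2.1 ∧ (L.map η).prod = z.2.1}⟩
  map_mul' u v := by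
    ext ⟨s, h, t⟩
    constructor
    · rintro ⟨L, hL, hh⟩
      dsimp only at hL hh
      rw [FreeSemigroup.letters_mul, ← List.append_assoc] at hL
      obtain ⟨L₁, L₂, m, rfl, hm, h1, h2⟩ := exists_split hY L t.2 hL
      exact ⟨⟨m, hm⟩, (L₁.map η).prod, (L₂.map η).prod, ⟨L₁, h1, rfl⟩, ⟨L₂, h2, rfl⟩, by
        rw [← hh, List.map_append, List.prod_append]⟩
    · rintro ⟨m, h1, h2, ⟨L₁, hL₁, rfl⟩, ⟨L₂, hL₂, rfl⟩, hh⟩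
      dsimp only at hL₁ hL₂ hh
      refine ⟨L₁ ++ L₂, ?_, by rw [List.map_append, List.prod_append, hh]⟩
      dsimp only
      rw [FreeSemigroup.letters_mul, ← List.append_assoc, hL₁, List.append_assoc, hL₂]
      simp

/-- The triples with empty remainders record complete factorizations over Y, and a code word product
has only one. -/
theorem prod_eq_of_trackHom_eq [Monoid H] (hY : ∀ y ∈ Y, y.letters.length ≤ M) (η : Y → H)
    (hcode : ∀ L L' : List Y, (L.map fun y => y.1.letters).flatten =
      (L'.map fun y => y.1.letters).flatten → L = L') {v v' : FreeSemigroup Y}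
    (h : trackHom hY η (wordInclusion Y v) = trackHom hY η (wordInclusion Y v')) :
    (v.letters.map η).prod = (v'.letters.map η).prod := by
  have hmem : ((⟨[], Nat.zero_le _⟩, (v.letters.map η).prod, ⟨[], Nat.zero_le _⟩) :
      {l : List A // l.length ≤ M} × H × {l : List A // l.length ≤ M}) ∈
      (trackHom hY η (wordInclusion Y v)).triples :=
    ⟨v.letters, by simp [ThueMorse.letters_wordInclusion], rfl⟩
  rw [h] at hmem
  obtain ⟨L, hL, hh⟩ := hmem
  dsimp only at hL hh
  rw [← hh, hcode v'.letters L (by simpa [ThueMorse.letters_wordInclusion] using hL)]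

end TrackValues

namespace ThueMorse

open FreeProfiniteSemigroup FreeProfiniteGroup

/-! ### The presentation of `G(τ)` -/

instance : Nonempty X := ⟨⟨AB.word .a [.b, .b, .a], by rw [X, returnSet_eq]; simp⟩⟩

theorem length_letters_le (x : FreeSemigroup AB) (hx : x ∈ X) : x.letters.length ≤ 8 := by
  obtain ⟨h1, h2⟩ := (mem_returnSet_iff x).1 hx
  exact (by decide : ∀ r ∈ pieces, r.length ≤ 8) _ (mem_pieces h1 h2)

theorem wordInclusion_lift {w : X → FreeSemigroup X}
    (hw : ∀ x, wordInclusion X (w x) = thueMorse (thueMorse x)) (v : FreeSemigroup X) :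
    wordInclusion X (FreeSemigroup.lift w v) = thueMorse (thueMorse (wordInclusion X v)) := by
  induction v using FreeSemigroup.recOnMul with
  | ih1 x => exact hw x
  | ih2 x v h1 h2 => simp only [map_mul, h1, h2]

theorem wordInclusion_iterate_lift {w : X → FreeSemigroup X}
    (hw : ∀ x, wordInclusion X (w x) = thueMorse (thueMorse x)) (n : ℕ) (v : FreeSemigroup X) :
    wordInclusion X ((FreeSemigroup.lift w)^[n] v) = thueMorse^[2 * n] (wordInclusion X v) := by
  induction n generalizing v with
  | zero => rfl
  | succ n ih =>
    rw [Function.iterate_succ_apply, ih, wordInclusion_lift hw, Nat.mul_succ,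
      Function.iterate_add_apply]
    rfl

theorem apply_ofPositive {Θ : FreeProfiniteGroup X →ₙ* FreeProfiniteSemigroup AB}
    (hΘ : ∀ x : X, Θ (of x) = thueMorse.omega x) (v : FreeSemigroup X) :
    Θ (ofPositive v) = thueMorse.omega (wordInclusion X v) := by
  induction v using FreeSemigroup.recOnMul with
  | ih1 x => exact hΘ x
  | ih2 x v h1 h2 => simp only [map_mul, h1, h2, omega_mul]

/-- The relations `ψ ^ ω (x) = x` hold in `G(τ)`. -/
theorem apply_omegaPower {w : X → FreeSemigroup X}
    (hw : ∀ x, wordInclusion X (w x) = thueMorse (thueMorse x))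
    {Θ : FreeProfiniteGroup X →ₙ* FreeProfiniteSemigroup AB} (hc : Continuous Θ)
    (hΘ : ∀ x : X, Θ (of x) = thueMorse.omega x) (x : X) :
    Θ (omegaPower (endOfWords w) (of x)) = Θ (of x) := by
  refine ext_coord fun c => ?_
  have := c.2
  obtain ⟨N, hN, hΩ⟩ := exists_liftFun_omegaPower_eq thueMorse c.1.mkMulHom
  have hlim : ∀ᶠ n : ℕ in atTop, (Θ ((endOfWords w)^[n.factorial] (of x))).1 c =
      (Θ (omegaPower (endOfWords w) (of x))).1 c :=
    (FreeProfiniteGroup.tendsto_omegaPower (endOfWords w) (of x)).eventually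
      (((isLocallyConstant_coord c).comp_continuous hc).eventually_eq _)
  obtain ⟨n, hn, hn'⟩ := (hlim.and (eventually_ge_atTop N)).exists
  obtain ⟨k, hk⟩ := Nat.dvd_factorial hN hn'
  -- With n! = Nk, the left side is the value of τ^{N + 2Nk}(x) modulo c, and N(1 + 2k) is also an
  -- admissible exponent for τ^ω(x).
  rw [← hn, ← ofPositive_of, iterate_endOfWords_ofPositive, apply_ofPositive hΘ,
    apply_ofPositive hΘ, wordInclusion_iterate_lift hw, ← liftFun_mkMulHom c,
    ← liftFun_mkMulHom c, Substitution.omega, Substitution.omega, hΩ 1 one_pos,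
    hΩ (1 + 2 * k) (by omega), ← iterate_map_ofWord, ← Function.iterate_add_apply, hk]
  congr 2
  ring

/-- A finite quotient of the free profinite group in which the relations `ψ ^ ω (x) = x` hold is
determined by a finite quotient of the free profinite semigroup. -/
theorem quotient_mk_eq_of_apply_eq {w : X → FreeSemigroup X}
    (hw : ∀ x, wordInclusion X (w x) = thueMorse (thueMorse x))
    {Θ : FreeProfiniteGroup X →ₙ* FreeProfiniteSemigroup AB} (hc : Continuous Θ)
    (hΘ : ∀ x : X, Θ (of x) = thueMorse.omega x) (M : Subgroup (FreeProfiniteGroup X)) [M.Normal]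
    (hM : IsOpen (M : Set (FreeProfiniteGroup X)))
    (hR : omegaRelators (endOfWords w) ⊆ M) {u u' : FreeProfiniteGroup X} (huu : Θ u = Θ u') :
    (QuotientGroup.mk u : FreeProfiniteGroup X ⧸ M) = QuotientGroup.mk u' := by
  have : Finite (FreeProfiniteGroup X ⧸ M) := M.quotient_finite_of_isOpen hM
  have : DiscreteTopology (FreeProfiniteGroup X ⧸ M) := QuotientGroup.discreteTopology hM
  let η : FreeProfiniteGroup X →* FreeProfiniteGroup X ⧸ M := QuotientGroup.mk' M
  have hη : IsLocallyConstant η := (IsLocallyConstant.iff_continuous _).2 continuous_quotient_mk'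
  let ρ := TrackValues.trackHom length_letters_le fun x : X => η (of x)
  have hprod : ∀ v : FreeSemigroup X, (v.letters.map fun x : X => η (of x)).prod =
      η (ofPositive v) := by
    intro v
    induction v using FreeSemigroup.recOnMul with
    | ih1 x => rw [FreeSemigroup.letters_of]; simp [ofPositive_of]
    | ih2 x v h1 h2 =>
      rw [FreeSemigroup.letters_mul, List.map_append, List.prod_append, h1, h2, map_mul, map_mul]
  have hrel : ∀ x : X, η (omegaPower (endOfWords w) (of x)) = η (of x) := by
    intro x
    have h : omegaPower (endOfWords w) (of x) * (of x)⁻¹ ∈ M := hR ⟨x, rfl⟩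
    rw [← div_eq_one, ← map_div, div_eq_mul_inv]
    exact (QuotientGroup.eq_one_iff _).2 h
  obtain ⟨N, hN, hΩ⟩ := exists_liftFun_omegaPower_eq thueMorse ρ
  -- Since X is finite, one n serves all generators; then ψ^{n!} does not change values under η.
  have hev : ∀ᶠ n : ℕ in atTop, ∀ x : X, η ((endOfWords w)^[n.factorial] (of x)) = η (of x) := by
    rw [eventually_all]
    intro x
    rw [← hrel x]
    exact (FreeProfiniteGroup.tendsto_omegaPower (endOfWords w) (of x)).eventually
      (hη.eventually_eq _)
  obtain ⟨n, hn, hn'⟩ := (hev.and (eventually_ge_atTop N)).exists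
  have hword : ∀ v : FreeSemigroup X,
      η (ofPositive ((FreeSemigroup.lift w)^[n.factorial] v)) = η (ofPositive v) := by
    intro v
    rw [← iterate_endOfWords_ofPositive]
    induction v using FreeSemigroup.recOnMul with
    | ih1 x => exact hn x
    | ih2 x v h1 h2 => rw [map_mul, iterate_map_mul, map_mul, map_mul, h1, h2]
  obtain ⟨k, hk⟩ := Nat.dvd_factorial hN hn'
  have hk' : 0 < k := Nat.pos_of_ne_zero fun h => by
    subst h
    exact Nat.factorial_ne_zero n (by simpa using hk)
  -- The exponent N·2k = 2·n! makes ρ evaluate τ^ω(i(v)) on an actual word over the code, namely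
  -- i(ψ^{n!}(v)).
  have hρ : ∀ v : FreeSemigroup X, liftFun ρ (Θ (ofPositive v)) =
      ρ (wordInclusion X ((FreeSemigroup.lift w)^[n.factorial] v)) := by
    intro v
    rw [apply_ofPositive hΘ, wordInclusion_iterate_lift hw, Substitution.omega,
      hΩ (2 * k) (by omega), iterate_map_ofWord, liftFun_ofWord, hk]
    congr 2
    ring
  have key : ∀ v v' : FreeSemigroup X, liftFun ρ (Θ (ofPositive v)) =
      liftFun ρ (Θ (ofPositive v')) → η (ofPositive v) = η (ofPositive v') := by
    intro v v' h
    rw [hρ, hρ] at h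
    rw [← hword v, ← hword v', ← hprod, ← hprod]
    exact TrackValues.prod_eq_of_trackHom_eq _ _ (fun _ _ => map_letters_eq_of_flatten_eq) h
  -- A single positive word approximates z for η and for ρ∘Θ simultaneously.
  have happrox : ∀ z : FreeProfiniteGroup X, ∃ v : FreeSemigroup X, η (ofPositive v) = η z ∧
      liftFun ρ (Θ (ofPositive v)) = liftFun ρ (Θ z) := by
    intro z
    exact exists_ofPositive_mem (W := {y | η y = η z} ∩ {y | liftFun ρ (Θ y) = liftFun ρ (Θ z)})
      ((hη.isOpen_fiber _).inter
        (((isLocallyConstant_liftFun ρ).comp_continuous hc).isOpen_fiber _)) ⟨rfl, rfl⟩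
  obtain ⟨v, h1, h2⟩ := happrox u
  obtain ⟨v', h1', h2'⟩ := happrox u'
  exact h1.symm.trans ((key v v' (by rw [h2, h2', huu])).trans h1')

/-- The elements with trivial image. -/
def kernel (Θ : FreeProfiniteGroup X →ₙ* FreeProfiniteSemigroup AB) :
    Subgroup (FreeProfiniteGroup X) where
  carrier := {u | Θ u = Θ 1}
  mul_mem' {u v} hu hv := by
    change Θ (u * v) = Θ 1
    rw [map_mul, show Θ u = Θ 1 from hu, show Θ v = Θ 1 from hv, ← map_mul, one_mul]
  one_mem' := rfl
  inv_mem' {u} hu := by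
    change Θ u⁻¹ = Θ 1
    rw [← mul_one u⁻¹, map_mul, ← show Θ u = Θ 1 from hu, ← map_mul, inv_mul_cancel]
    exact hu.symm

theorem mem_kernel {Θ : FreeProfiniteGroup X →ₙ* FreeProfiniteSemigroup AB}
    {u : FreeProfiniteGroup X} : u ∈ kernel Θ ↔ Θ u = Θ 1 := Iff.rfl

instance (Θ : FreeProfiniteGroup X →ₙ* FreeProfiniteSemigroup AB) : (kernel Θ).Normal where
  conj_mem u hu g := by
    rw [mem_kernel, map_mul, map_mul, mem_kernel.1 hu, ← map_mul, ← map_mul, mul_one,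
      mul_inv_cancel]

/-- One inclusion holds because the kernel is closed, normal and contains the relators. For the
other, an element outside the closure is missed by an open normal subgroup containing the relators,
whose finite quotient factors through Θ. -/
theorem topologicalClosure_normalClosure_eq_kernel {w : X → FreeSemigroup X}
    (hw : ∀ x, wordInclusion X (w x) = thueMorse (thueMorse x))
    {Θ : FreeProfiniteGroup X →ₙ* FreeProfiniteSemigroup AB} (hc : Continuous Θ)
    (hΘ : ∀ x : X, Θ (of x) = thueMorse.omega x) :
    (Subgroup.normalClosure (omegaRelators (endOfWords w))).topologicalClosure = kernel Θ := by
  apply le_antisymm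
  · refine Subgroup.topologicalClosure_minimal _ (Subgroup.normalClosure_le_normal ?_)
      (isClosed_eq hc continuous_const)
    rintro _ ⟨x, rfl⟩
    change Θ _ = Θ 1
    rw [map_mul, apply_omegaPower hw hc hΘ, ← map_mul, mul_inv_cancel]
  · intro u hu
    by_contra hu'
    obtain ⟨M, hM, hMo, hle, huM⟩ := exists_open_normal_not_mem _
      (Subgroup.isClosed_topologicalClosure _) hu'
    refine huM ((QuotientGroup.eq_one_iff u).1 (quotient_mk_eq_of_apply_eq hw hc hΘ M hMo ?_
      (mem_kernel.1 hu)))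
    exact Subgroup.subset_normalClosure.trans ((Subgroup.le_topologicalClosure _).trans hle)

/-- The kernel computation makes the induced map injective, hence an embedding by compactness; its
range is closed and contains the dense elements τ^ω(i(v)). -/
theorem exists_presentation {w : X → FreeSemigroup X}
    (hw : ∀ x, wordInclusion X (w x) = thueMorse (thueMorse x)) :
    ∃ e : PresentedProfiniteGroup (omegaRelators (endOfWords w)) →ₙ* FreeProfiniteSemigroup AB,
      Topology.IsEmbedding e ∧ Set.range e = thueMorse.G .a .a ∧
      ∀ x : X, e (QuotientGroup.mk (of x)) = thueMorse.omega x := by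
  obtain ⟨i, hi, hG⟩ := exists_idempotent_G_eq
  obtain ⟨Θ, hc, hmem, hΘ⟩ := exists_continuous_mulHom hi (fun x : X => thueMorse.omega x)
    fun x => hG ▸ omega_mem_G_of_returnSet x
  have hker := topologicalClosure_normalClosure_eq_kernel hw hc hΘ
  have hmk : ∀ u v : FreeProfiniteGroup X,
      (QuotientGroup.mk u : PresentedProfiniteGroup (omegaRelators (endOfWords w))) =
        QuotientGroup.mk v ↔ Θ u = Θ v := by
    intro u v
    rw [QuotientGroup.eq, hker, mem_kernel, map_mul]
    constructor
    · intro h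
      have := congrArg (Θ u * ·) h
      rw [← map_mul, ← map_mul, ← map_mul, mul_inv_cancel_left, mul_one] at this
      exact this.symm
    · intro h
      rw [← h, ← map_mul, inv_mul_cancel]
  let e : PresentedProfiniteGroup (omegaRelators (endOfWords w)) →ₙ* FreeProfiniteSemigroup AB :=
    { toFun := fun q => Quotient.liftOn' q Θ fun u v h => (hmk u v).1 (Quotient.sound' h)
      map_mul' := by
        rintro ⟨u⟩ ⟨v⟩
        exact map_mul Θ u v }
  have hec : Continuous e := hc.quotient_liftOn' _
  refine ⟨e, ?_, ?_, hΘ⟩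
  · refine (hec.isClosedEmbedding ?_).isEmbedding
    rintro ⟨u⟩ ⟨v⟩ h
    exact (hmk u v).2 h
  · apply subset_antisymm
    · rintro _ ⟨⟨u⟩, rfl⟩
      exact hG ▸ hmem u
    · refine G_subset_closure_range.trans (closure_minimal ?_ (isCompact_range hec).isClosed)
      rintro _ ⟨v, rfl⟩
      exact ⟨QuotientGroup.mk (ofPositive v), apply_ofPositive hΘ v⟩

end ThueMorse

theorem corollaryc :
    thueMorse.IsConnection AB.a AB.a ∧
    thueMorse.returnSet AB.a AB.a =
      {AB.word .a [.b, .b, .a], AB.word .a [.b, .a, .b, .b, .a],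
        AB.word .a [.b, .b, .a, .b, .a], AB.word .a [.b, .a, .b, .b, .a, .b, .a]} ∧
    Maximal IsSubgroupOfSemigroup (thueMorse.G AB.a AB.a) ∧
    thueMorse.G AB.a AB.a ⊆ thueMorse.J ∧
    -- the unique decomposition `w x` of `τ²(x)` over `X_τ(a, a)`, for `x` in `X_τ(a, a)`
    ∃ w : thueMorse.returnSet AB.a AB.a → FreeSemigroup (thueMorse.returnSet AB.a AB.a),
      (∀ (x : thueMorse.returnSet AB.a AB.a) (v : FreeSemigroup (thueMorse.returnSet AB.a AB.a)),
        wordInclusion (thueMorse.returnSet AB.a AB.a) v = thueMorse (thueMorse x) ↔ v = w x) ∧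
      -- an isomorphism of topological groups from the presented group onto `G(τ)`
      ∃ e : PresentedProfiniteGroup (omegaRelators (FreeProfiniteGroup.endOfWords w)) →ₙ*
          FreeProfiniteSemigroup AB,
        Topology.IsEmbedding e ∧ Set.range e = thueMorse.G AB.a AB.a ∧
        ∀ x : thueMorse.returnSet AB.a AB.a,
          e (QuotientGroup.mk (FreeProfiniteGroup.of x)) = thueMorse.omega x := by
  choose w hw using ThueMorse.exists_decomposition_thueMorse_sq
  refine ⟨ThueMorse.isConnection, ThueMorse.returnSet_eq, ThueMorse.maximal_G,
    ThueMorse.G_subset_J, w, fun x v => ⟨fun h => ?_, fun h => h ▸ hw x⟩,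
    ThueMorse.exists_presentation hw⟩
  exact ThueMorse.wordInclusion_injective (h.trans (hw x).symm)
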